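/- All graphs are finite and simple. Write $N(H,G)$ for the number of subgraphs of $G$ isomorphic to $H$, $e(G)$ for the number of edges of $G$, $T_{r}(n)$ for the Turán graph (the complete $r$-partite graph on $n$ vertices whose class sizes differ by at most one), and $\mathrm{ex}(n,H,F)$ for the maximum of $N(H,G)$ over all $n$-vertex graphs $G$ that do not contain $F$ as a subgraph ($F$-free graphs). Let $F$ be a graph with chromatic number $\chi(F)=k\ge 3$ that has a color-critical edge, i.e. an edge whose deletion results in a graph with smaller chromatic number, and let $H$ be a connected graph with $\chi(H)<k$. Suppose that every $n$-vertex $F$-free graph $G$ with $N(H,G)=\mathrm{ex}(n,H,F)$ is T-extremal, i.e. $|e(G)-e(T_{k-1}(n))|=o(n^2)$ as $n\to\infty$ (for every $\varepsilon>0$ and every $n$ large enough, all these $G$ satisfy $|e(G)-e(T_{k-1}(n))|\le\varepsilon n^2$). Suppose also that $H$ has the weak $k$-T-property: for every $n$ large enough, each complete $(k-1)$-partite graph $K=K_{t_1,\ldots,t_{k-1}}$ with all $t_i\ge 1$ and $t_1+\cdots+t_{k-1}=n$ satisfies $N(H,K)\le N(H,T_{k-1}(n))$, with equality if and only if $K\cong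 T_{k-1}(n)$. Then, for every $n$ large enough, every $n$-vertex $F$-free graph $G$ with $N(H,G)=\mathrm{ex}(n,H,F)$ is isomorphic to $T_{k-1}(n)$. -/

import Mathlib

namespace GenTuran

open Filter

/-- The number `N(H, G)` of (unlabelled) copies of `H` in the finite graph `G`: the number of
subgraphs of `G` isomorphic to `H`. -/
noncomputable abbrev N {W V : Type*} [Fintype V] (H : SimpleGraph W) (G : SimpleGraph V) : ℕ :=
  G.copyCount H

/-- The number `e(G)` of edges of `G`. -/
noncomputable abbrev e {V : Type*} (G : SimpleGraph V) : ℕ :=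
  G.edgeSet.ncard

/-- `F` has a color-critical edge: an edge whose deletion results in a graph with smaller
chromatic number. -/
def HasColorCriticalEdge {U : Type*} (F : SimpleGraph U) : Prop :=
  ∃ f ∈ F.edgeSet, (F.deleteEdges {f}).chromaticNumber < F.chromaticNumber

open scoped Classical in
/-- The generalized Turán number `ex(n, H, F)`: the largest number of copies of `H` in an
`F`-free graph on `n` vertices. -/
noncomputable def ex {W U : Type*} (n : ℕ) (H : SimpleGraph W) (F : SimpleGraph U) : ℕ :=
  Finset.sup {G : SimpleGraph (Fin n) | F.Free G} (fun G => N H G)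

/-- `G` is an extremal graph for `(H, F)`: an `F`-free graph on `n` vertices with
`N(H, G) = ex(n, H, F)`. -/
def IsExtremalGraph {W U : Type*} {n : ℕ} (H : SimpleGraph W) (F : SimpleGraph U)
    (G : SimpleGraph (Fin n)) : Prop :=
  F.Free G ∧ N H G = ex n H F

/-- Every extremal graph `G` for `(H, F)` on `n` vertices is T-extremal, that is,
`|e(G) - e(T_{k-1}(n))| = o(n^2)` as `n` tends to infinity. -/
def ExtremalGraphsAreTExtremal {W U : Type*} (k : ℕ) (H : SimpleGraph W) (F : SimpleGraph U) :
    Prop :=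
  ∀ ε : ℝ, 0 < ε → ∀ᶠ n : ℕ in atTop, ∀ G : SimpleGraph (Fin n), IsExtremalGraph H F G →
    |(e G : ℝ) - (e (SimpleGraph.turanGraph n (k - 1)) : ℝ)| ≤ ε * (n : ℝ) ^ 2

/-- The complete multipartite graph `K_{t_1, …, t_r}`. -/
abbrev completePartite {r : ℕ} (t : Fin r → ℕ) : SimpleGraph (Σ i, Fin (t i)) :=
  SimpleGraph.completeMultipartiteGraph (fun i => Fin (t i))

/-- `H` has the weak `k`-T-property: for every large enough `n`, each complete `(k-1)`-partite
graph `K` on `n` vertices (with nonempty classes) satisfies `N(H, K) ≤ N(H, T_{k-1}(n))`, with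
equality if and only if `K` is isomorphic to `T_{k-1}(n)`. -/
def WeakTProperty {W : Type*} (k : ℕ) (H : SimpleGraph W) : Prop :=
  ∀ᶠ n : ℕ in atTop, ∀ t : Fin (k - 1) → ℕ, (∀ i, 0 < t i) → ∑ i, t i = n →
    N H (completePartite t) ≤ N H (SimpleGraph.turanGraph n (k - 1)) ∧
    (N H (completePartite t) = N H (SimpleGraph.turanGraph n (k - 1)) ↔
      Nonempty (completePartite t ≃g SimpleGraph.turanGraph n (k - 1)))

end GenTuran

/-!
# Extremal graphs for generalized Turán problems with a critical edge

Write `r = k - 1`. The proof shows that a large extremal graph `G` is exactly `r`-partite; then it is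
complete `r`-partite by extremality, and the weak T-property identifies it as the Turán graph.

The critical edge enters through two greedy embeddings into sets `A 1, …, A r` that are almost
completely joined to each other. A vertex with many neighbours in every `A i` creates a copy of `F`
(`isContained_of_many_neighbors`), and so does an edge whose ends have many common neighbours in all
`A j` with `j ≠ i` (`isContained_of_adj_of_common_neighbors`).

*Stability.* A dense `F`-free graph has a large vertex set `S` with minimum degree close to
`(1 - 1 / r) |S|`, and by the Erdős–Stone theorem `S` contains a complete `r`-partite graph `K` with
parts of constant size `t`. Each vertex sees few vertices of some part of `K`, and by double
counting almost every vertex of `S` sees almost all the remaining ones. Two vertices missing the same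
part are not adjacent, because of the second embedding. This colours almost all vertices
(`exists_almost_coloring`), and counting edges gives large, almost completely joined parts `A i`
(`exists_almost_complete_parts`).

*Exactness.* Any vertex `v` has few neighbours in some `A i`. Joining `v` to exactly the other parts
keeps the graph `F`-free (`free_rejoin`). The copies of `H` that this destroys use one of the few
edges from `v` to `A i` or to the exceptional vertices, while each missing edge from `v` to another
part creates of the order of `n ^ (|W| - 2)` labelled copies of `H`. As `G` is extremal, `v` must be
joined to almost all vertices of the other parts (`card_nonadj_le`). The second embedding then
shows that two adjacent vertices never belong to the same part, so that `G` is `r`-partite without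
exceptions (`exists_coloring_of_forall_N_le`). A missing edge between two classes would be contained
in a copy of `H` in the complete multipartite graph, which is `F`-free (`eq_of_N_le`).

Copies of `H` are counted with labels, which multiplies all counts by the number of automorphisms
of `H` (`card_labelledCopies`). All that is needed from `H` besides its colourability is an edge,
and an edgeless `H` has extremal graphs without edges, which are not T-extremal.
-/

namespace GenTuran

open Finset

/-! ### Greedy embeddings and the critical edge -/

/-- `φ` is a colouring of `F` minus the edge `u₀v₀`, in which `u₀` and `v₀` get the same colour. -/
def IsCriticalColoring {U : Type*} {r : ℕ} (F : SimpleGraph U) (u₀ v₀ : U) (φ : U → Fin r) :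
    Prop :=
  F.Adj u₀ v₀ ∧ φ u₀ = φ v₀ ∧
    ∀ u w, F.Adj u w → φ u = φ w → (u = u₀ ∧ w = v₀) ∨ (u = v₀ ∧ w = u₀)

theorem exists_isCriticalColoring {U : Type*} {F : SimpleGraph U} {k : ℕ}
    (hk : 3 ≤ k) (hF : F.chromaticNumber = (k : ℕ∞)) (hcrit : HasColorCriticalEdge F) :
    ∃ (u₀ v₀ : U) (φ : U → Fin (k - 1)), IsCriticalColoring F u₀ v₀ φ := by
  obtain ⟨f, hf, hlt⟩ := hcrit
  induction f using Sym2.ind with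
  | _ u₀ v₀ =>
  rw [hF] at hlt
  have hcol : (F.deleteEdges {s(u₀, v₀)}).Colorable (k - 1) := by
    apply SimpleGraph.chromaticNumber_le_iff_colorable.1
    have : (k : ℕ∞) = ((k - 1 : ℕ) : ℕ∞) + 1 := by
      have : k = (k - 1) + 1 := by omega
      exact_mod_cast this
    rw [this] at hlt
    exact Order.le_of_lt_add_one hlt
  obtain ⟨φ⟩ := hcol
  have key : ∀ u w, F.Adj u w → φ u = φ w → (u = u₀ ∧ w = v₀) ∨ (u = v₀ ∧ w = u₀) := by
    intro u w huw he
    by_contra hne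
    refine φ.valid (v := u) (w := w) ?_ he
    rw [SimpleGraph.deleteEdges_adj]
    refine ⟨huw, fun h => hne ?_⟩
    simpa using h
  refine ⟨u₀, v₀, φ, hf, ?_, key⟩
  -- Otherwise `φ` would properly colour all of `F` with `k - 1` colours.
  by_contra hne
  have : F.Colorable (k - 1) := ⟨SimpleGraph.Coloring.mk φ fun {u w} huw he => by
    rcases key u w huw he with ⟨rfl, rfl⟩ | ⟨rfl, rfl⟩
    · exact hne he
    · exact hne he.symm⟩
  have h2 := this.chromaticNumber_le
  rw [hF] at h2
  have h3 : k ≤ k - 1 := by exact_mod_cast h2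
  omega

open scoped Classical in
/-- A long list `B` has an element outside the image of `f` that is joined to all `f u` with `p u`,
provided that each of these `f u` has few non-neighbours in `B`. -/
theorem exists_common_neighbor {U V : Type*} [Fintype U] {G : SimpleGraph V} (B : Finset V)
    (f : U → V) (p : U → Prop) (m : ℕ) (hB : Fintype.card U * (m + 1) < #B)
    (hp : ∀ u, p u → #{x ∈ B | ¬ G.Adj x (f u)} ≤ m) :
    ∃ x ∈ B, (∀ u, x ≠ f u) ∧ ∀ u, p u → G.Adj x (f u) := by
  by_contra hcon
  push Not at hcon
  have hsub : B ⊆ (univ : Finset U).biUnion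
      (fun w => {x ∈ B | x = f w ∨ (p w ∧ ¬ G.Adj x (f w))}) := by
    intro x hx
    simp only [mem_biUnion, mem_univ, true_and, mem_filter]
    by_cases h : ∀ w, x ≠ f w
    · obtain ⟨w, hw⟩ := hcon x hx h
      exact ⟨w, hx, .inr hw⟩
    · push Not at h
      obtain ⟨w, hw⟩ := h
      exact ⟨w, hx, .inl hw⟩
  have h1 := (card_le_card hsub).trans (card_biUnion_le_card_mul _ _ (m + 1) fun w _ => ?_)
  · rw [card_univ] at h1
    exact absurd hB (not_lt.2 h1)
  · rw [filter_or]
    refine (card_union_le _ _).trans ?_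
    rw [add_comm m 1]
    refine add_le_add ?_ ?_
    · refine card_le_one.2 fun a ha b hb => ?_
      rw [(mem_filter.1 ha).2, (mem_filter.1 hb).2]
    · by_cases hw : p w
      · simpa [hw] using hp w hw
      · simp [hw]

open scoped Classical in
/-- Greedy embedding: outside a set `P` of vertices whose images are unproblematic, every vertex
`u` has a list `S u` of candidates so long that the choices made for the other vertices cannot
exhaust it. -/
theorem exists_injective_hom {U V : Type*} [Fintype U] {F : SimpleGraph U} {G : SimpleGraph V}
    (P : Finset U) (S : U → Finset V) (m : ℕ)
    (hne : ∀ u ∈ P, (S u).Nonempty)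
    (hP : ∀ f : U → V, (∀ u, f u ∈ S u) →
      Set.InjOn f P ∧ ∀ u ∈ P, ∀ w ∈ P, F.Adj u w → G.Adj (f u) (f w))
    (hcard : ∀ u ∉ P, Fintype.card U * (m + 1) < #(S u))
    (hS : ∀ u ∉ P, ∀ w, F.Adj u w → ∀ y ∈ S w, #{x ∈ S u | ¬ G.Adj x y} ≤ m) :
    ∃ f : U → V, (∀ u, f u ∈ S u) ∧ Function.Injective f ∧
      ∀ u w, F.Adj u w → G.Adj (f u) (f w) := by
  have hstep : ∀ u ∉ P, ∀ f : U → V, (∀ w, f w ∈ S w) →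
      ∃ x ∈ S u, (∀ w, x ≠ f w) ∧ ∀ w, F.Adj u w → G.Adj x (f w) := by
    intro u hu f hf
    exact exists_common_neighbor (S u) f (F.Adj u) m (hcard u hu)
      fun w huw => hS u hu w huw (f w) (hf w)
  have hne' : ∀ u, (S u).Nonempty := fun u => by
    by_cases hu : u ∈ P
    · exact hne u hu
    · exact card_pos.1 ((Nat.zero_le _).trans_lt (hcard u hu))
  have main : ∀ Q : Finset U, ∃ f : U → V, (∀ u, f u ∈ S u) ∧
      Set.InjOn f (P ∪ Q : Finset U) ∧
      ∀ u ∈ P ∪ Q, ∀ w ∈ P ∪ Q, F.Adj u w → G.Adj (f u) (f w) := by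
    intro Q
    induction Q using Finset.induction_on with
    | empty =>
      choose f hf using hne'
      rw [union_empty]
      exact ⟨f, hf, hP f hf⟩
    | insert u Q _ ih =>
      obtain ⟨f, hf, hinj, hadj⟩ := ih
      rw [union_insert]
      by_cases hu : u ∈ P ∪ Q
      · rw [insert_eq_of_mem hu]
        exact ⟨f, hf, hinj, hadj⟩
      · have huP : u ∉ P := fun h => hu (mem_union_left _ h)
        obtain ⟨x, hx, hxne, hxadj⟩ := hstep u huP f hf
        have hupd : ∀ w ∈ P ∪ Q, Function.update f u x w = f w := fun w hw =>
          Function.update_of_ne (by rintro rfl; exact hu hw) _ _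
        refine ⟨Function.update f u x, fun w => ?_, ?_, ?_⟩
        · by_cases hw : w = u
          · subst hw; simpa using hx
          · rw [Function.update_of_ne hw]; exact hf w
        · intro a ha b hb hab
          rw [mem_coe, mem_insert] at ha hb
          rcases ha with rfl | ha <;> rcases hb with rfl | hb
          · rfl
          · rw [hupd b hb, Function.update_self] at hab
            exact absurd hab (hxne b)
          · rw [hupd a ha, Function.update_self] at hab
            exact absurd hab.symm (hxne a)
          · rw [hupd a ha, hupd b hb] at hab
            exact hinj ha hb hab
        · intro a ha b hb hab
          rw [mem_insert] at ha hb
          rcases ha with rfl | ha <;> rcases hb with rfl | hb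
          · exact absurd rfl hab.ne
          · rw [hupd b hb, Function.update_self]
            exact hxadj b hab
          · rw [hupd a ha, Function.update_self]
            exact (hxadj a hab.symm).symm
          · rw [hupd a ha, hupd b hb]
            exact hadj a ha b hb hab
  obtain ⟨f, hf, hinj, hadj⟩ := main univ
  refine ⟨f, hf, fun a b hab => hinj (by simp) (by simp) hab, fun u w huw => ?_⟩
  exact hadj u (by simp) w (by simp) huw

theorem isContained_of_injective_hom {U V : Type*} {F : SimpleGraph U} {G : SimpleGraph V}
    (f : U → V) (hf : Function.Injective f) (h : ∀ u w, F.Adj u w → G.Adj (f u) (f w)) :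
    F.IsContained G :=
  ⟨⟨⟨f, fun {a b} hab => h a b hab⟩, hf⟩⟩

open scoped Classical in
/-- If the sets `A i` are almost completely joined to each other, then a vertex with many
neighbours in all of them creates a copy of `F`: it plays the role of an end of the critical
edge. -/
theorem isContained_of_many_neighbors {U V : Type*} [Fintype U] {F : SimpleGraph U}
    {G : SimpleGraph V} {r : ℕ} {u₀ v₀ : U} {φ : U → Fin r} (hφ : IsCriticalColoring F u₀ v₀ φ)
    (A : Fin r → Finset V) (m : ℕ)
    (hA : ∀ i j, i ≠ j → ∀ y ∈ A i, #{x ∈ A j | ¬ G.Adj x y} ≤ m) (v : V)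
    (hv : ∀ i, Fintype.card U * (m + 1) < #{x ∈ A i | G.Adj v x}) : F.IsContained G := by
  obtain ⟨f, -, hinj, hadj⟩ := exists_injective_hom (F := F) (G := G) {u₀}
    (fun u => if u = u₀ then {v} else {x ∈ A (φ u) | G.Adj v x}) m
    (by simp) (fun f _ => by simp) (fun u hu => by
      rw [mem_singleton] at hu
      simpa [hu] using hv (φ u))
    (fun u hu w huw y hy => by
      rw [mem_singleton] at hu
      simp only [hu, if_false]
      by_cases hw : w = u₀
      · simp only [hw, if_true, mem_singleton] at hy
        subst hy
        rw [filter_filter, filter_false_of_mem]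
        · simp
        · rintro x - ⟨h1, h2⟩
          exact h2 h1.symm
      · simp only [hw, if_false, mem_filter] at hy
        refine (card_le_card ?_).trans (hA (φ w) (φ u) (fun he => ?_) y hy.1)
        · exact filter_subset_filter _ (filter_subset _ _)
        · rcases hφ.2.2 u w huw he.symm with h | h
          · exact hu h.1
          · exact hw h.2)
  exact isContained_of_injective_hom f hinj hadj

open scoped Classical in
/-- If the sets `A i` are almost completely joined to each other, then two adjacent vertices with
many common neighbours in all sets but `A i` create a copy of `F`: they play the role of the
critical edge, the other vertices of its colour going to `A i`. -/
theorem isContained_of_adj_of_common_neighbors {U V : Type*} [Fintype U] {F : SimpleGraph U}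
    {G : SimpleGraph V} {r : ℕ} {u₀ v₀ : U} {φ : U → Fin r} (hφ : IsCriticalColoring F u₀ v₀ φ)
    (A : Fin r → Finset V) (m : ℕ)
    (hA : ∀ i j, i ≠ j → ∀ y ∈ A i, #{x ∈ A j | ¬ G.Adj x y} ≤ m) (a b : V) (hab : G.Adj a b)
    (i : Fin r) (hi : Fintype.card U * (m + 1) < #(A i))
    (hj : ∀ j, j ≠ i → Fintype.card U * (m + 1) < #{x ∈ A j | G.Adj a x ∧ G.Adj b x}) :
    F.IsContained G := by
  -- Permute the colours so that the critical edge has colour `i`.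
  set σ : Equiv.Perm (Fin r) := Equiv.swap (φ u₀) i with hσ
  set ψ : U → Fin r := fun u => σ (φ u) with hψ
  have hu : ψ u₀ = i := by simp [hψ, hσ]
  have hv : ψ v₀ = i := by rw [← hu]; simp [hψ, hφ.2.1]
  have hne : u₀ ≠ v₀ := hφ.1.ne
  have hψ2 : ∀ u w, F.Adj u w → ψ u = ψ w → (u = u₀ ∧ w = v₀) ∨ (u = v₀ ∧ w = u₀) :=
    fun u w h he => hφ.2.2 u w h (σ.injective he)
  set S : U → Finset V := fun u => if u = u₀ then {a} else if u = v₀ then {b} else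
    if ψ u = i then A i else {x ∈ A (ψ u) | G.Adj a x ∧ G.Adj b x} with hS
  have hS1 : S u₀ = {a} := by simp [hS]
  have hS2 : S v₀ = {b} := by simp [hS, hne.symm]
  have hS3 : ∀ u, u ≠ u₀ → u ≠ v₀ → S u ⊆ A (ψ u) := by
    intro u h1 h2
    simp only [hS, h1, h2, if_false]
    split_ifs with h
    · rw [h]
    · exact filter_subset _ _
  have hS4 : ∀ u, u ≠ u₀ → u ≠ v₀ → ψ u ≠ i →
      S u = {x ∈ A (ψ u) | G.Adj a x ∧ G.Adj b x} := by
    intro u h1 h2 h3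
    simp [hS, h1, h2, h3]
  obtain ⟨f, -, hinj, hadj⟩ := exists_injective_hom (F := F) (G := G) {u₀, v₀} S m
    (by simp [hS1, hS2]) (fun f hf => by
      have h1 : f u₀ = a := by simpa [hS1] using hf u₀
      have h2 : f v₀ = b := by simpa [hS2] using hf v₀
      refine ⟨?_, ?_⟩
      · intro x hx y hy hxy
        simp only [coe_insert, coe_singleton, Set.mem_insert_iff, Set.mem_singleton_iff] at hx hy
        rcases hx with rfl | rfl <;> rcases hy with rfl | rfl
        · rfl
        · rw [h1, h2] at hxy; exact absurd hxy hab.ne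
        · rw [h1, h2] at hxy; exact absurd hxy hab.ne'
        · rfl
      · intro x hx y hy hxy
        simp only [mem_insert, mem_singleton] at hx hy
        rcases hx with rfl | rfl <;> rcases hy with rfl | rfl
        · exact absurd rfl hxy.ne
        · rw [h1, h2]; exact hab
        · rw [h1, h2]; exact hab.symm
        · exact absurd rfl hxy.ne)
    (fun u hu => by
      simp only [mem_insert, mem_singleton, not_or] at hu
      by_cases h : ψ u = i
      · simpa [hS, hu.1, hu.2, h] using hi
      · rw [hS4 u hu.1 hu.2 h]
        exact hj _ h)
    (fun u hu' w huw y hy => by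
      simp only [mem_insert, mem_singleton, not_or] at hu'
      obtain ⟨hu1, hu2⟩ := hu'
      have hcol : ψ u ≠ ψ w := fun he => by
        rcases hψ2 u w huw he with h | h
        · exact hu1 h.1
        · exact hu2 h.1
      by_cases hw : w = u₀ ∨ w = v₀
      · have hui : ψ u ≠ i := by
          rcases hw with rfl | rfl
          · rwa [hu] at hcol
          · rwa [hv] at hcol
        rw [hS4 u hu1 hu2 hui, filter_filter, filter_false_of_mem]
        · simp
        · rintro x - ⟨⟨h1, h1'⟩, h2⟩
          rcases hw with rfl | rfl
          · rw [hS1, mem_singleton] at hy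
            subst hy
            exact h2 h1.symm
          · rw [hS2, mem_singleton] at hy
            subst hy
            exact h2 h1'.symm
      · push Not at hw
        exact (card_le_card (filter_subset_filter _ (hS3 u hu1 hu2))).trans
          (hA (ψ w) (ψ u) hcol.symm y (hS3 w hw.1 hw.2 hy)))
  exact isContained_of_injective_hom f hinj hadj

/-! ### Erdős–Stone bounds and dense subsets of large minimum degree -/

open scoped Classical in
/-- The number of neighbours of `v` in `S`. -/
noncomputable def degIn {V : Type*} (G : SimpleGraph V) (S : Finset V) (v : V) : ℕ :=
  #{w ∈ S | G.Adj v w}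

/-- Twice the number of edges of `G` inside `S`, as a sum of degrees. -/
noncomputable def twiceEdges {V : Type*} (G : SimpleGraph V) (S : Finset V) : ℕ :=
  ∑ v ∈ S, degIn G S v

theorem degIn_le_card {V : Type*} (G : SimpleGraph V) (S : Finset V) (v : V) :
    degIn G S v ≤ #S := by
  classical exact card_filter_le _ _

theorem twiceEdges_le_sq {V : Type*} (G : SimpleGraph V) (S : Finset V) :
    twiceEdges G S ≤ #S ^ 2 := by
  rw [sq]
  exact sum_le_card_nsmul _ _ _ fun v _ => degIn_le_card G S v

open scoped Classical in
theorem degIn_erase {V : Type*} (G : SimpleGraph V) {S : Finset V} {v : V}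
    (hv : v ∈ S) (w : V) :
    degIn G S w = degIn G (S.erase v) w + (if G.Adj w v then 1 else 0) := by
  unfold degIn
  conv_lhs => rw [← insert_erase hv]
  rw [filter_insert]
  split_ifs with h
  · rw [card_insert_of_notMem (by simp)]
  · rfl

open scoped Classical in
theorem twiceEdges_erase {V : Type*} (G : SimpleGraph V) {S : Finset V} {v : V}
    (hv : v ∈ S) : twiceEdges G S = twiceEdges G (S.erase v) + 2 * degIn G S v := by
  unfold twiceEdges
  rw [← add_sum_erase _ _ hv, sum_congr rfl (fun w _ => degIn_erase G hv w), sum_add_distrib]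
  have : ∑ w ∈ S.erase v, (if G.Adj w v then 1 else 0) = degIn G S v := by
    rw [degIn_erase G hv v, ← card_filter]
    simp only [SimpleGraph.irrefl, if_false, add_zero, degIn]
    congr 1
    ext w
    simp [SimpleGraph.adj_comm]
  rw [this]
  ring

/-- Deleting vertices of small degree as long as possible, phrased as the choice of a subset
maximizing `2 e(S) - c (|S| ^ 2 + |S|)`. -/
theorem exists_subset_large_degIn {V : Type*} (G : SimpleGraph V) (T : Finset V) (c : ℝ) :
    ∃ S ⊆ T, (∀ v ∈ S, c * #S ≤ degIn G S v) ∧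
      (twiceEdges G T : ℝ) - c * ((#T : ℝ) ^ 2 + #T) ≤
        twiceEdges G S - c * ((#S : ℝ) ^ 2 + #S) := by
  classical
  obtain ⟨S, hS, hmax⟩ := exists_max_image T.powerset
    (fun S => (twiceEdges G S : ℝ) - c * ((#S : ℝ) ^ 2 + #S)) ⟨T, by simp⟩
  rw [mem_powerset] at hS
  refine ⟨S, hS, fun v hv => ?_, hmax T (by simp)⟩
  have h1 := hmax (S.erase v) (mem_powerset.2 ((erase_subset _ _).trans hS))
  have h2 : (#(S.erase v) : ℝ) = #S - 1 := by
    rw [card_erase_of_mem hv, Nat.cast_pred (card_pos.2 ⟨v, hv⟩)]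
  have h3 : (twiceEdges G S : ℝ) = twiceEdges G (S.erase v) + 2 * degIn G S v := by
    exact_mod_cast twiceEdges_erase G hv
  simp only [h2, h3] at h1
  nlinarith

/-- The minimum degree version of the Erdős–Stone theorem, inside a vertex subset `S`. -/
theorem exists_completeEquipartite_of_degIn {δ : ℝ} (hδ : 0 < δ) (r t : ℕ) :
    ∃ s₀ : ℕ, ∀ {V : Type*} (G : SimpleGraph V) (S : Finset V), s₀ ≤ #S →
      (∀ v ∈ S, (1 - 1 / r + δ) * #S ≤ degIn G S v) →
      ∃ f : Fin (r + 1) × Fin t → V, Function.Injective f ∧ (∀ x, f x ∈ S) ∧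
        ∀ x y, x.1 ≠ y.1 → G.Adj (f x) (f y) := by
  obtain ⟨s₀, hs₀⟩ := Filter.eventually_atTop.1
    (SimpleGraph.eventually_completeEquipartiteGraph_isContained_of_minDegree hδ r t)
  refine ⟨max s₀ 1, fun {V} G S hS hdeg => ?_⟩
  classical
  let e : Fin #S ≃ S := S.equivFin.symm
  let G' : SimpleGraph (Fin #S) := G.comap (fun x => (e x : V))
  have : Nonempty (Fin #S) := Fin.pos_iff_nonempty.1 ((le_max_right _ _).trans hS)
  have hmin : (G'.minDegree : ℝ) ≥ (1 - 1 / r + δ) * (#S : ℕ) := by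
    obtain ⟨x, hx⟩ := G'.exists_minimal_degree_vertex
    rw [hx]
    have h1 := hdeg (e x) (e x).2
    have h2 : G'.degree x = degIn G S (e x) := by
      rw [← SimpleGraph.card_neighborFinset_eq_degree, degIn]
      refine card_bij (fun y _ => (e y : V)) (fun y hy => ?_) (fun y _ z _ h => ?_)
        (fun y hy => ?_)
      · rw [SimpleGraph.mem_neighborFinset] at hy
        exact mem_filter.2 ⟨(e y).2, hy⟩
      · exact e.injective (Subtype.ext h)
      · rw [mem_filter] at hy
        refine ⟨e.symm ⟨y, hy.1⟩, ?_, by simp⟩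
        rw [SimpleGraph.mem_neighborFinset]
        simpa [G'] using hy.2
    rw [h2]
    exact h1
  obtain ⟨g⟩ := hs₀ #S ((le_max_left _ _).trans hS) (G := G') hmin
  refine ⟨fun x => e (g x), fun x y h => ?_, fun x => (e _).2, fun x y h => ?_⟩
  · exact g.injective (e.injective (Subtype.ext h))
  · exact g.toHom.map_adj (v := x) (w := y) h

/-- The edge version of the Erdős–Stone theorem, as an upper bound for `F`-free graphs. -/
theorem twiceEdges_le_of_free {U : Type*} [Fintype U] {F : SimpleGraph U} {r : ℕ}
    (hF : F.Colorable (r + 1)) (hr : 0 < r) {δ : ℝ} (hδ : 0 < δ) :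
    ∃ n₀ : ℕ, ∀ {V : Type*} (G : SimpleGraph V), F.Free G → ∀ T : Finset V, n₀ ≤ #T →
      (twiceEdges G T : ℝ) ≤ (1 - 1 / r + δ) * (#T : ℝ) ^ 2 := by
  classical
  obtain ⟨s₀, hs₀⟩ := exists_completeEquipartite_of_degIn (half_pos hδ) r (Fintype.card U)
  obtain ⟨n₁, hn₁⟩ := exists_nat_gt (4 * (1 + δ) / δ)
  obtain ⟨n₂, hn₂⟩ := exists_nat_gt ((s₀ : ℝ) ^ 2 * (4 / δ))
  refine ⟨max (max n₁ n₂) 1, fun {V} G hG T hT => ?_⟩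
  by_contra hcon
  push Not at hcon
  have hr1 : (1 : ℝ) / r ≤ 1 := by
    rw [div_le_one (by positivity)]; exact_mod_cast hr
  have hr0 : (0 : ℝ) ≤ 1 / r := by positivity
  obtain ⟨S, hST, hdeg, hS⟩ := exists_subset_large_degIn G T (1 - 1 / r + δ / 2)
  have hT1 : (n₁ : ℝ) ≤ #T := by exact_mod_cast (le_max_left _ _).trans ((le_max_left _ _).trans hT)
  have hT2 : (n₂ : ℝ) ≤ #T := by
    exact_mod_cast (le_max_right _ _).trans ((le_max_left _ _).trans hT)
  have hT3 : (1 : ℝ) ≤ #T := by exact_mod_cast (le_max_right _ _).trans hT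
  have hSsq : (twiceEdges G S : ℝ) ≤ (#S : ℝ) ^ 2 := by exact_mod_cast twiceEdges_le_sq G S
  have hSnn : (0 : ℝ) ≤ (1 - 1 / r + δ / 2) * ((#S : ℝ) ^ 2 + #S) :=
    mul_nonneg (by linarith) (by positivity)
  have hT4 : 4 * (1 + δ) ≤ δ * #T := by
    rw [div_lt_iff₀ hδ] at hn₁; nlinarith
  have h1 : (1 - 1 / r + δ / 2) * (#T : ℝ) ≤ (1 + δ) * #T :=
    mul_le_mul_of_nonneg_right (by linarith) (by linarith)
  have h2 : δ / 4 * (#T : ℝ) ^ 2 ≤ (#S : ℝ) ^ 2 := by nlinarith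
  have h3 : (s₀ : ℝ) ^ 2 ≤ (#S : ℝ) ^ 2 := by
    have : (s₀ : ℝ) ^ 2 ≤ #T * (δ / 4) := by
      rw [← mul_div_assoc, div_lt_iff₀ hδ] at hn₂; nlinarith
    nlinarith
  have h4 : s₀ ≤ #S := by
    have := abs_le_of_sq_le_sq' h3 (by positivity)
    exact_mod_cast this.2
  obtain ⟨f, hinj, -, hadj⟩ := hs₀ G S h4 hdeg
  obtain ⟨φ⟩ := hF
  have hFc : F.IsContained (SimpleGraph.completeEquipartiteGraph (r + 1) (Fintype.card U)) :=
    SimpleGraph.isContained_completeEquipartiteGraph_of_colorable φ _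
      fun c => Fintype.card_subtype_le _
  exact hG (hFc.trans ⟨⟨⟨f, fun {a b} h => hadj a b h⟩, hinj⟩⟩)

/-- In a dense `F`-free graph almost all vertices lie in a set inside which the minimum degree is
almost that of the Turán graph. -/
theorem exists_large_subset_degIn {U : Type*} [Fintype U] {F : SimpleGraph U} {r : ℕ}
    (hF : F.Colorable (r + 1)) (hr : 2 ≤ r) {δ η : ℝ} (hδ : 0 < δ) (hδ' : δ ≤ 1 / 2)
    (hη : 0 < η) (hη' : η ≤ 1) (s₀ : ℕ) :
    ∃ ε > 0, ∃ n₀ : ℕ, ∀ {V : Type*} [Fintype V] (G : SimpleGraph V), F.Free G →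
      n₀ ≤ Fintype.card V →
      (1 - 1 / r - ε) * (Fintype.card V : ℝ) ^ 2 ≤ twiceEdges G univ →
      ∃ S : Finset V, s₀ ≤ #S ∧ (1 - η) * Fintype.card V ≤ #S ∧
        ∀ v ∈ S, (1 - 1 / r - δ) * #S ≤ degIn G S v := by
  set ε : ℝ := δ * η / 4 with hε
  have hεpos : 0 < ε := by positivity
  have hεδ : ε ≤ δ / 4 := by rw [hε]; nlinarith
  obtain ⟨n₁, hn₁⟩ := twiceEdges_le_of_free (F := F) hF (by omega) hεpos
  obtain ⟨n₂, hn₂⟩ := exists_nat_gt (1 / ε)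
  obtain ⟨n₃, hn₃⟩ := exists_nat_gt (((max n₁ s₀ : ℕ) : ℝ) ^ 2 * (2 / δ))
  refine ⟨ε, hεpos, max (max n₂ n₃) 1, fun {V} _ G hG hn he => ?_⟩
  have hr1 : (1 : ℝ) / r ≤ 1 / 2 := by
    apply one_div_le_one_div_of_le (by norm_num); exact_mod_cast hr
  have hr0 : (0 : ℝ) ≤ 1 / r := by positivity
  obtain ⟨S, -, hdeg, hS⟩ := exists_subset_large_degIn G univ (1 - 1 / r - δ)
  rw [card_univ] at hS
  have hn2 : (n₂ : ℝ) ≤ Fintype.card V := by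
    exact_mod_cast (le_max_left _ _).trans ((le_max_left _ _).trans hn)
  have hn3 : (n₃ : ℝ) ≤ Fintype.card V := by
    exact_mod_cast (le_max_right _ _).trans ((le_max_left _ _).trans hn)
  have hn1 : (1 : ℝ) ≤ Fintype.card V := by exact_mod_cast (le_max_right _ _).trans hn
  have hs0 : (0 : ℝ) ≤ #S := by positivity
  have hSsq : (twiceEdges G S : ℝ) ≤ (#S : ℝ) ^ 2 := by exact_mod_cast twiceEdges_le_sq G S
  have h4' : ((max n₁ s₀ : ℕ) : ℝ) ≤ #S → max n₁ s₀ ≤ #S := fun h => by exact_mod_cast h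
  have hup := hn₁ G hG S
  set n : ℝ := (Fintype.card V : ℝ)
  set s : ℝ := (#S : ℝ)
  have hεn : n ≤ ε * n ^ 2 := by
    rw [div_lt_iff₀ hεpos] at hn₂
    have h : 1 ≤ ε * n := by nlinarith
    nlinarith
  have hc0 : (0 : ℝ) ≤ 1 - 1 / r - δ := by linarith
  have hcn : (1 - 1 / r - δ) * n ≤ n := by nlinarith
  have hcs : 0 ≤ (1 - 1 / r - δ) * s := mul_nonneg hc0 hs0
  have h1 : (δ - 2 * ε) * n ^ 2 + (1 - 1 / r - δ) * s ^ 2 ≤ twiceEdges G S := by nlinarith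
  have h2 : δ / 2 * n ^ 2 ≤ s ^ 2 := by
    have : 0 ≤ (1 - 1 / r - δ) * s ^ 2 := mul_nonneg hc0 (by positivity)
    nlinarith [sq_nonneg n]
  have h3 : ((max n₁ s₀ : ℕ) : ℝ) ^ 2 ≤ s ^ 2 := by
    have : ((max n₁ s₀ : ℕ) : ℝ) ^ 2 ≤ n * (δ / 2) := by
      rw [← mul_div_assoc, div_lt_iff₀ hδ] at hn₃; nlinarith
    nlinarith
  have h4 : max n₁ s₀ ≤ #S := h4' (abs_le_of_sq_le_sq' h3 hs0).2
  have h5 := hup ((le_max_left _ _).trans h4)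
  refine ⟨S, (le_max_right _ _).trans h4, ?_, hdeg⟩
  by_contra hlt
  push Not at hlt
  have h6 : (δ - 2 * ε) * n ^ 2 ≤ (δ + ε) * s ^ 2 := by linarith
  have h8 : 0 ≤ 1 - η := by linarith
  have h7 : s ^ 2 ≤ (1 - η) * n ^ 2 := by
    have h9 : s ^ 2 ≤ ((1 - η) * n) ^ 2 := pow_le_pow_left₀ hs0 hlt.le 2
    have h10 : ((1 - η) * n) ^ 2 = (1 - η) * n ^ 2 - η * ((1 - η) * n ^ 2) := by ring
    have h11 : 0 ≤ η * ((1 - η) * n ^ 2) := by positivity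
    linarith
  have h12 : (δ - 2 * ε) * n ^ 2 ≤ (δ + ε) * ((1 - η) * n ^ 2) :=
    h6.trans (mul_le_mul_of_nonneg_left h7 (by positivity))
  have h13 : 0 < n ^ 2 := by positivity
  have h14 : δ - 2 * ε ≤ (δ + ε) * (1 - η) := by
    rw [← mul_assoc] at h12
    exact le_of_mul_le_mul_right h12 h13
  have h15 : δ * η = 4 * ε := by rw [hε]; ring
  have h16 : 0 < ε * η := mul_pos hεpos hη
  have h17 : (δ + ε) * (1 - η) = δ + ε - δ * η - ε * η := by ring
  linarith

/-! ### Stability: almost all of a dense `F`-free graph is `r`-colourable -/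

open scoped Classical in
/-- Let `f` embed a complete `(q+1)`-partite graph with parts of size `t` in an `F`-free graph.
Any vertex sees few vertices of one part, and the vertices seeing few vertices of the part `i` and
almost all vertices outside of it form an independent set. -/
theorem exists_coloring_of_completeEquipartite {U V : Type*} [Fintype U] {F : SimpleGraph U}
    {G : SimpleGraph V} {q t : ℕ} {u₀ v₀ : U} {φ : U → Fin (q + 1)}
    (hφ : IsCriticalColoring F u₀ v₀ φ) (hG : F.Free G) (ht : 6 * Fintype.card U < t)
    (f : Fin (q + 1) × Fin t → V) (hinj : Function.Injective f)
    (hadj : ∀ x y, x.1 ≠ y.1 → G.Adj (f x) (f y)) :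
    ∃ c : V → Fin (q + 1), (∀ v, #{x | G.Adj v (f x)} ≤ q * t + Fintype.card U) ∧
      ∀ a b, 4 * q * t ≤ 4 * #{x | G.Adj a (f x)} + t → 4 * q * t ≤ 4 * #{x | G.Adj b (f x)} + t →
        c a = c b → ¬ G.Adj a b := by
  set K : Fin (q + 1) → Finset V := fun i =>
    univ.map ⟨fun j : Fin t => f (i, j), fun j j' h => (Prod.ext_iff.1 (hinj h)).2⟩ with hK
  have hA : ∀ i j, i ≠ j → ∀ y ∈ K i, #{x ∈ K j | ¬ G.Adj x y} ≤ 0 := by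
    intro i j hij y hy
    rw [filter_false_of_mem]
    · simp
    · intro x hx
      simp only [hK, mem_map, mem_univ, true_and] at hx hy
      obtain ⟨a, rfl⟩ := hx
      obtain ⟨b, rfl⟩ := hy
      exact not_not.2 (hadj _ _ hij.symm)
  have hcardK : ∀ i, #(K i) = t := by simp [hK]
  set N : V → Fin (q + 1) → ℕ := fun v i => #{j : Fin t | G.Adj v (f (i, j))} with hN
  have hKN : ∀ v i, #{x ∈ K i | G.Adj v x} = N v i := by
    intro v i
    simp only [hK, hN, filter_map, card_map]
    rfl
  have hNt : ∀ v i, N v i ≤ t := fun v i => by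
    rw [← hKN, ← hcardK i]; exact card_filter_le _ _
  have hsum : ∀ v, #{x | G.Adj v (f x)} = ∑ i, N v i := by
    intro v
    simp only [hN, card_filter, Fintype.sum_prod_type]
  have hc : ∀ v, ∃ i, N v i ≤ Fintype.card U := by
    intro v
    by_contra hcon
    push Not at hcon
    exact hG (isContained_of_many_neighbors hφ K 0 hA v fun i => by simpa [hKN] using hcon i)
  choose c hc using hc
  have hsplit : ∀ v, #{x | G.Adj v (f x)} = N v (c v) + ∑ i ∈ univ.erase (c v), N v i := fun v => by
    rw [hsum, add_sum_erase _ _ (mem_univ _)]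
  refine ⟨c, fun v => ?_, fun a b ha hb hab hadj' => ?_⟩
  · rw [hsplit]
    have : ∑ i ∈ univ.erase (c v), N v i ≤ q * t := by
      refine (sum_le_card_nsmul _ _ t fun i _ => hNt v i).trans ?_
      simp [card_erase_of_mem]
    linarith [hc v]
  · have hlarge : ∀ v, 4 * q * t ≤ 4 * #{x | G.Adj v (f x)} + t → ∀ j, j ≠ c v →
        3 * t ≤ 4 * N v j + 4 * Fintype.card U := by
      intro v hv j hj
      have hj' : j ∈ univ.erase (c v) := mem_erase.2 ⟨hj, mem_univ _⟩
      rw [hsplit, ← add_sum_erase _ _ hj'] at hv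
      have h1 : ∑ i ∈ (univ.erase (c v)).erase j, N v i ≤ (q - 1) * t := by
        refine (sum_le_card_nsmul _ _ t fun i _ => hNt v i).trans ?_
        simp [card_erase_of_mem hj', card_erase_of_mem]
      have hq : q = (q - 1) + 1 := by
        have : 0 < #(univ.erase (c v)) := card_pos.2 ⟨j, hj'⟩
        simp [card_erase_of_mem] at this
        omega
      have h2 : 4 * q * t = 4 * ((q - 1) * t) + 4 * t := by
        conv_lhs => rw [hq]
        ring
      have := hc v
      omega
    refine hG (isContained_of_adj_of_common_neighbors hφ K 0 hA a b hadj' (c a) ?_ fun j hj => ?_)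
    · rw [hcardK]; omega
    · have h1 := hlarge a ha j hj
      have h2 := hlarge b hb j (hab ▸ hj)
      have h3 := card_union_add_card_inter {x ∈ K j | G.Adj a x} {x ∈ K j | G.Adj b x}
      rw [← filter_and, hKN, hKN] at h3
      have h4 : #({x ∈ K j | G.Adj a x} ∪ {x ∈ K j | G.Adj b x}) ≤ t := by
        rw [← hcardK j]
        exact card_le_card (union_subset (filter_subset _ _) (filter_subset _ _))
      omega

/-- Stability for graphs with a critical edge: a dense `F`-free graph becomes `r`-colourable
after the deletion of few vertices. -/
theorem exists_almost_coloring {U : Type*} [Fintype U] {F : SimpleGraph U} {r : ℕ} {u₀ v₀ : U}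
    {φ : U → Fin r} (hφ : IsCriticalColoring F u₀ v₀ φ) (hF : F.Colorable (r + 1)) (hr : 2 ≤ r)
    {η : ℝ} (hη : 0 < η) (hη' : η ≤ 1) :
    ∃ ε > 0, ∃ n₀ : ℕ, ∀ {V : Type*} [Fintype V] (G : SimpleGraph V), F.Free G →
      n₀ ≤ Fintype.card V →
      (1 - 1 / r - ε) * (Fintype.card V : ℝ) ^ 2 ≤ twiceEdges G univ →
      ∃ (X : Finset V) (c : V → Fin r), (#X : ℝ) ≤ η * Fintype.card V ∧
        ∀ a b, a ∉ X → b ∉ X → c a = c b → ¬ G.Adj a b := by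
  classical
  obtain ⟨q, rfl⟩ : ∃ q, r = q + 1 := ⟨r - 1, by omega⟩
  have hq : 1 ≤ q := by omega
  set u := Fintype.card U with hu
  obtain ⟨t, ht⟩ := exists_nat_gt (16 * u / η)
  have htu : 16 * (u : ℝ) ≤ η * t := by
    rw [div_lt_iff₀ hη] at ht; linarith
  have hupos : 0 < u := Fintype.card_pos_iff.2 ⟨u₀⟩
  have ht6 : 6 * u < t := by
    have h1 : η * t ≤ t := mul_le_of_le_one_left (by positivity) hη'
    have h2 : 16 * u ≤ t := by exact_mod_cast htu.trans h1
    omega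
  have htpos : (0 : ℝ) < t := by exact_mod_cast (Nat.zero_le _).trans_lt ht6
  set R : ℝ := (q : ℝ) + 1 with hR
  have hqpos : (0 : ℝ) < q := by exact_mod_cast hq
  have hRpos : 0 < R := by positivity
  set δ : ℝ := min (η / (16 * R)) (1 / (2 * q * R)) with hδ
  have hδpos : 0 < δ := by positivity
  have hδ1 : δ * R ≤ η / 16 := by
    have : δ ≤ η / (16 * R) := min_le_left _ _
    calc δ * R ≤ η / (16 * R) * R := by gcongr
      _ = η / 16 := by field_simp
  have hδ2 : δ ≤ 1 / (2 * q * R) := min_le_right _ _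
  have hδ3 : δ ≤ 1 / 2 := by
    refine hδ2.trans (one_div_le_one_div_of_le (by norm_num) ?_)
    have : (1 : ℝ) ≤ q := by exact_mod_cast hq
    nlinarith
  have hδ' : (0 : ℝ) < 1 / (2 * q * R) := by positivity
  obtain ⟨s₀, hs₀⟩ := exists_completeEquipartite_of_degIn hδ' q t
  obtain ⟨ε, hε, n₀, hn₀⟩ := exists_large_subset_degIn (F := F) hF hr hδpos hδ3
    (half_pos hη) (by linarith) s₀
  refine ⟨ε, hε, n₀, fun {V} _ G hG hn he => ?_⟩
  obtain ⟨S, hSs, hSn, hdeg⟩ := hn₀ G hG hn he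
  push_cast at hdeg
  rw [← hR] at hdeg
  obtain ⟨f, hinj, hfS, hadj⟩ := hs₀ G S hSs fun v hv => by
    refine le_trans ?_ (hdeg v hv)
    refine mul_le_mul_of_nonneg_right ?_ (by positivity)
    have : 1 / (q : ℝ) - 1 / R = 2 * (1 / (2 * q * R)) := by
      rw [hR]; field_simp; ring
    linarith
  obtain ⟨c, hc1, hc2⟩ := exists_coloring_of_completeEquipartite hφ hG ht6 f hinj hadj
  set X' : Finset V := {v ∈ S | 4 * #{x | G.Adj v (f x)} + t < 4 * q * t} with hX'
  refine ⟨Sᶜ ∪ X', c, ?_, fun a b ha hb => ?_⟩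
  · -- Double count the edges between `S` and the image of `f`.
    have hlow : R * t * ((1 - 1 / R - δ) * #S) ≤ ((∑ v ∈ S, #{x | G.Adj v (f x)} : ℕ) : ℝ) := by
      have h1 : ∑ v ∈ S, #{x | G.Adj v (f x)} = ∑ x, degIn G S (f x) := by
        simp only [card_filter, degIn]
        rw [sum_comm]
        simp only [SimpleGraph.adj_comm]
      rw [h1]
      push_cast
      have h2 := card_nsmul_le_sum (univ : Finset (Fin (q + 1) × Fin t))
        (fun x => (degIn G S (f x) : ℝ)) ((1 - 1 / R - δ) * #S) fun x _ => hdeg _ (hfS x)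
      refine le_trans (le_of_eq ?_) h2
      simp [hR]
    have hup : ((∑ v ∈ S, #{x | G.Adj v (f x)} : ℕ) : ℝ) ≤ #S * (q * t + u) - #X' * (t / 4) := by
      have h1 : ∀ v ∈ S, (#{x | G.Adj v (f x)} : ℝ) ≤
          (q * t + u) - (if 4 * #{x | G.Adj v (f x)} + t < 4 * q * t then (t : ℝ) / 4 else 0) := by
        intro v _
        split_ifs with h
        · have h' : 4 * (#{x | G.Adj v (f x)} : ℝ) + t < 4 * q * t := by exact_mod_cast h
          have : (0 : ℝ) ≤ u := by positivity
          linarith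
        · rw [sub_zero]; exact_mod_cast hc1 v
      push_cast
      refine (sum_le_sum h1).trans (le_of_eq ?_)
      rw [sum_sub_distrib, ← sum_filter, sum_const, sum_const, nsmul_eq_mul, nsmul_eq_mul]
    have h1 : R * t * ((1 - 1 / R - δ) * #S) = (q * t - δ * R * t) * #S := by
      have : R * (1 / R) = 1 := by field_simp
      have h2 : R * t * ((1 - 1 / R - δ) * #S) = (R - R * (1 / R) - δ * R) * t * #S := by ring
      rw [h2, this, hR]; ring
    rw [h1] at hlow
    have h2 : δ * R * t * #S ≤ η / 16 * t * #S := by gcongr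
    have h3 : (u : ℝ) * #S ≤ η / 16 * t * #S := by gcongr; linarith
    have h4 : (#X' : ℝ) * t ≤ (η / 2 * #S) * t := by nlinarith
    have h5 : (#X' : ℝ) ≤ η / 2 * #S := le_of_mul_le_mul_right h4 htpos
    have h6 : (#S : ℝ) ≤ Fintype.card V := by exact_mod_cast card_le_univ S
    have h7 : (#Sᶜ : ℝ) = Fintype.card V - #S := by
      rw [card_compl, Nat.cast_sub (card_le_univ S)]
    have h8 : (#(Sᶜ ∪ X') : ℝ) ≤ #Sᶜ + #X' := by exact_mod_cast card_union_le _ _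
    have h9 : η / 2 * #S ≤ η / 2 * Fintype.card V := by gcongr
    linarith
  · simp only [mem_union, mem_compl, not_or, not_not, hX', mem_filter, not_and, not_lt] at ha hb
    exact hc2 a b (ha.2 ha.1) (hb.2 hb.1)

/-! ### The almost complete `r`-partite structure -/

open scoped Classical in
/-- Let `c` be a proper colouring of `G` outside a set `X`. If `G` has almost as many edges as the
Turán graph, then the colour classes have almost equal sizes and few pairs of vertices from
different classes are non-adjacent. -/
theorem sum_sq_add_sum_nonadj_le {V : Type*} [Fintype V] {G : SimpleGraph V} {r : ℕ} (hr : 2 ≤ r)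
    {ε : ℝ} (hdense : (1 - 1 / r - ε) * (Fintype.card V : ℝ) ^ 2 ≤ twiceEdges G univ)
    (X : Finset V) (c : V → Fin r) (hc : ∀ a b, a ∉ X → b ∉ X → c a = c b → ¬ G.Adj a b) :
    (∑ i, ((#{v | v ∉ X ∧ c v = i} : ℝ) - Fintype.card V / r) ^ 2) +
      ∑ a ∈ Xᶜ, (#{b | b ∉ X ∧ c b ≠ c a ∧ ¬ G.Adj a b} : ℝ) ≤
      ε * (Fintype.card V : ℝ) ^ 2 + Fintype.card V * #X := by
  set n := Fintype.card V with hn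
  set C : Fin r → Finset V := fun i => {v | v ∉ X ∧ c v = i} with hC
  set mis : V → ℕ := fun a => #{b | b ∉ X ∧ c b ≠ c a ∧ ¬ G.Adj a b} with hmis
  have hdeg : ∀ a ∈ Xᶜ, degIn G univ a + #(C (c a)) + mis a ≤ n := by
    intro a ha
    rw [mem_compl] at ha
    have h1 : Disjoint ({w | G.Adj a w} : Finset V) (C (c a)) := by
      rw [disjoint_left]
      intro w hw hw'
      simp only [hC, mem_filter, mem_univ, true_and] at hw hw'
      exact hc a w ha hw'.1 hw'.2.symm hw
    have h2 : Disjoint (({w | G.Adj a w} : Finset V) ∪ C (c a))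
        ({b | b ∉ X ∧ c b ≠ c a ∧ ¬ G.Adj a b} : Finset V) := by
      rw [disjoint_left]
      intro w hw hw'
      simp only [hC, mem_union, mem_filter, mem_univ, true_and] at hw hw'
      rcases hw with h | h
      · exact hw'.2.2 h
      · exact hw'.2.1 h.2
    rw [degIn, ← card_union_of_disjoint h1, ← card_union_of_disjoint h2]
    exact card_le_univ _
  have hfib : ∀ g : Fin r → ℝ, ∑ a ∈ Xᶜ, g (c a) = ∑ i, (#(C i) : ℝ) * g i := by
    intro g
    rw [← sum_fiberwise Xᶜ c]
    refine sum_congr rfl fun i _ => ?_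
    have : ({a ∈ Xᶜ | c a = i} : Finset V) = C i := by
      ext a; simp [hC]
    rw [this, sum_congr rfl (g := fun _ => g i), sum_const, nsmul_eq_mul]
    intro a ha
    simp only [hC, mem_filter] at ha
    rw [ha.2.2]
  have hXc : (#Xᶜ : ℝ) = n - #X := by
    rw [card_compl, Nat.cast_sub (card_le_univ X)]
  have hsumC : ∑ i, (#(C i) : ℝ) = n - #X := by
    have := hfib fun _ => 1
    simpa [hXc] using this.symm
  have hup : (twiceEdges G univ : ℝ) ≤
      (n : ℝ) ^ 2 - ∑ i, (#(C i) : ℝ) ^ 2 - ∑ a ∈ Xᶜ, (mis a : ℝ) := by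
    have h1 : (twiceEdges G univ : ℝ) =
        ∑ a ∈ X, (degIn G univ a : ℝ) + ∑ a ∈ Xᶜ, (degIn G univ a : ℝ) := by
      rw [sum_add_sum_compl, twiceEdges]; push_cast; rfl
    have h2 : ∑ a ∈ X, (degIn G univ a : ℝ) ≤ #X * n := by
      rw [← nsmul_eq_mul]
      exact sum_le_card_nsmul _ _ _ fun a _ => by exact_mod_cast degIn_le_card G univ a
    have h3 : ∑ a ∈ Xᶜ, (degIn G univ a : ℝ) ≤
        ∑ a ∈ Xᶜ, ((n : ℝ) - (#(C (c a)) : ℝ) - mis a) := by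
      refine sum_le_sum fun a ha => ?_
      have : (degIn G univ a : ℝ) + #(C (c a)) + mis a ≤ n := by exact_mod_cast hdeg a ha
      linarith
    rw [sum_sub_distrib, sum_sub_distrib, sum_const, nsmul_eq_mul, hXc,
      hfib fun i => (#(C i) : ℝ)] at h3
    simp only [sq] at *
    linarith
  have hsq : ∑ i, ((#(C i) : ℝ) - n / r) ^ 2 =
      ∑ i, (#(C i) : ℝ) ^ 2 - (n : ℝ) ^ 2 / r + 2 * (n * #X) / r := by
    have hr0 : (r : ℝ) ≠ 0 := by
      have : r ≠ 0 := by omega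
      exact_mod_cast this
    simp only [sub_sq, sum_add_distrib, sum_sub_distrib, sum_const, card_univ, Fintype.card_fin,
      ← sum_mul, ← mul_sum, hsumC, nsmul_eq_mul]
    field_simp
    ring
  rw [hsq]
  have h4 : 2 * ((n : ℝ) * #X) / r ≤ n * #X := by
    rw [div_le_iff₀ (by positivity)]
    have : (2 : ℝ) ≤ r := by exact_mod_cast hr
    have h5 : (0 : ℝ) ≤ n * #X := by positivity
    nlinarith
  have h5 : (1 - 1 / (r : ℝ) - ε) * (n : ℝ) ^ 2 = (n : ℝ) ^ 2 - (n : ℝ) ^ 2 / r - ε * (n : ℝ) ^ 2 := by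
    ring
  linarith

open scoped Classical in
/-- A dense `F`-free graph is, up to a small set of vertices, an almost complete `r`-partite graph
with large parts `A i`. -/
theorem exists_almost_complete_parts {U : Type*} [Fintype U] {F : SimpleGraph U} {r : ℕ}
    {u₀ v₀ : U} {φ : U → Fin r} (hφ : IsCriticalColoring F u₀ v₀ φ) (hF : F.Colorable (r + 1))
    (hr : 2 ≤ r) {α γ : ℝ} (hα : 0 < α) (hγ : 0 < γ) :
    ∃ ε > 0, ∃ n₀ : ℕ, ∀ {V : Type*} [Fintype V] (G : SimpleGraph V), F.Free G →
      n₀ ≤ Fintype.card V →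
      (1 - 1 / r - ε) * (Fintype.card V : ℝ) ^ 2 ≤ twiceEdges G univ →
      ∃ A : Fin r → Finset V, (#(univ.biUnion A)ᶜ : ℝ) ≤ γ * Fintype.card V ∧
        (∀ i, (Fintype.card V : ℝ) / (2 * r) ≤ #(A i)) ∧
        ∀ i j, i ≠ j → ∀ y ∈ A i, (#{x ∈ A j | ¬ G.Adj x y} : ℝ) ≤ α * Fintype.card V := by
  have hr0 : (0 : ℝ) < r := by
    have : 0 < r := by omega
    exact_mod_cast this
  set m : ℝ := min γ (1 / (4 * r)) with hm
  have hm0 : 0 < m := by positivity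
  set ρ : ℝ := min (1 / (16 * r ^ 2)) (α * (m / 2)) with hρ
  have hρ0 : 0 < ρ := by positivity
  set η : ℝ := min (min (ρ / 2) (m / 2)) 1 with hη
  have hη0 : 0 < η := by positivity
  have hηρ : η ≤ ρ / 2 := (min_le_left _ _).trans (min_le_left _ _)
  have hηm : η ≤ m / 2 := (min_le_left _ _).trans (min_le_right _ _)
  obtain ⟨ε, hε, n₀, hn₀⟩ := exists_almost_coloring hφ hF hr hη0 (min_le_right _ _)
  refine ⟨min ε (ρ / 2), by positivity, max n₀ 1, fun {V} _ G hG hn he => ?_⟩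
  obtain ⟨X, c, hX, hc⟩ := hn₀ G hG ((le_max_left _ _).trans hn) <| by
    refine le_trans ?_ he
    gcongr
    exact min_le_left _ _
  have hmain := sum_sq_add_sum_nonadj_le hr he X c hc
  have hn1 : (1 : ℝ) ≤ Fintype.card V := by exact_mod_cast (le_max_right _ _).trans hn
  set n : ℝ := (Fintype.card V : ℝ) with hndef
  set mis : V → ℕ := fun a => #{b | b ∉ X ∧ c b ≠ c a ∧ ¬ G.Adj a b} with hmis
  have hbound : min ε (ρ / 2) * n ^ 2 + n * #X ≤ ρ * n ^ 2 := by
    have h1 : min ε (ρ / 2) * n ^ 2 ≤ ρ / 2 * n ^ 2 := by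
      gcongr; exact min_le_right _ _
    have h2 : n * #X ≤ n * (ρ / 2 * n) := by
      gcongr; exact hX.trans (by gcongr)
    nlinarith
  have hmis0 : (0 : ℝ) ≤ ∑ a ∈ Xᶜ, (mis a : ℝ) :=
    sum_nonneg fun _ _ => Nat.cast_nonneg _
  have hsq0 : (0 : ℝ) ≤ ∑ i, ((#{v | v ∉ X ∧ c v = i} : ℝ) - n / r) ^ 2 :=
    sum_nonneg fun _ _ => sq_nonneg _
  -- Vertices missing too many edges to the other classes are discarded as well.
  set Y : Finset V := {a ∈ Xᶜ | α * n < mis a} with hY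
  have hYcard : (#Y : ℝ) ≤ m / 2 * n := by
    have h1 : (#Y : ℝ) * (α * n) ≤ ∑ a ∈ Xᶜ, (mis a : ℝ) := by
      rw [← nsmul_eq_mul]
      refine (card_nsmul_le_sum Y (fun a => (mis a : ℝ)) _ fun a ha => ?_).trans
        (sum_le_sum_of_subset_of_nonneg (filter_subset _ _) fun _ _ _ => Nat.cast_nonneg _)
      exact (mem_filter.1 ha).2.le
    have h2 : ρ ≤ α * (m / 2) := min_le_right _ _
    have h3 : ρ * n ^ 2 ≤ α * (m / 2) * n ^ 2 := by gcongr
    have h4 : (#Y : ℝ) * (α * n) ≤ (m / 2 * n) * (α * n) := by nlinarith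
    exact le_of_mul_le_mul_right h4 (by positivity)
  have hB : (#(X ∪ Y) : ℝ) ≤ m * n := by
    have h1 : (#(X ∪ Y) : ℝ) ≤ #X + #Y := by exact_mod_cast card_union_le _ _
    have h2 : η * n ≤ m / 2 * n := by gcongr
    linarith
  set A : Fin r → Finset V := fun i => {v | v ∉ X ∪ Y ∧ c v = i} with hA
  have hmem : ∀ i v, v ∈ A i ↔ v ∉ X ∪ Y ∧ c v = i := fun i v =>
    mem_filter.trans (by simp only [mem_univ, true_and])
  refine ⟨A, ?_, fun i => ?_, fun i j hij y hy => ?_⟩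
  · have : (univ.biUnion A)ᶜ ⊆ X ∪ Y := by
      intro v hv
      by_contra hv'
      rw [mem_compl, mem_biUnion] at hv
      exact hv ⟨c v, mem_univ _, (hmem _ _).2 ⟨hv', rfl⟩⟩
    calc (#(univ.biUnion A)ᶜ : ℝ) ≤ #(X ∪ Y) := by exact_mod_cast card_le_card this
      _ ≤ m * n := hB
      _ ≤ γ * n := by gcongr; exact min_le_left _ _
  · have h1 : ((#{v | v ∉ X ∧ c v = i} : ℝ) - n / r) ^ 2 ≤ ρ * n ^ 2 := by
      have := single_le_sum (f := fun i => ((#{v | v ∉ X ∧ c v = i} : ℝ) - n / r) ^ 2)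
        (fun _ _ => sq_nonneg _) (mem_univ i)
      linarith
    have h2 : ρ * n ^ 2 ≤ (n / (4 * r)) ^ 2 := by
      have : ρ ≤ 1 / (16 * r ^ 2) := min_le_left _ _
      calc ρ * n ^ 2 ≤ 1 / (16 * r ^ 2) * n ^ 2 := by gcongr
        _ = (n / (4 * r)) ^ 2 := by field_simp; norm_num
    have h3 := (abs_le_of_sq_le_sq' (h1.trans h2) (by positivity)).1
    have h4 : (#{v | v ∉ X ∧ c v = i} : ℝ) ≤ #(A i) + #Y := by
      have : ({v | v ∉ X ∧ c v = i} : Finset V) ⊆ A i ∪ Y := by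
        intro v hv
        simp only [mem_filter, mem_univ, true_and] at hv
        by_cases hvY : v ∈ Y
        · exact mem_union_right _ hvY
        · exact mem_union_left _ ((hmem _ _).2 ⟨by simp [hv.1, hvY], hv.2⟩)
      exact_mod_cast (card_le_card this).trans (card_union_le _ _)
    have h5 : m / 2 * n ≤ n / (8 * r) := by
      have : m ≤ 1 / (4 * r) := min_le_right _ _
      calc m / 2 * n ≤ (1 / (4 * r)) / 2 * n := by gcongr
        _ = n / (8 * r) := by field_simp; norm_num
    have h6 : n / (2 * r) = 4 * (n / (8 * r)) := by field_simp; norm_num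
    have h7 : n / r = 8 * (n / (8 * r)) := by field_simp
    have h8 : n / (4 * r) = 2 * (n / (8 * r)) := by field_simp; norm_num
    have h9 : 0 ≤ n / (8 * r) := by positivity
    linarith
  · rw [hmem] at hy
    have h1 : y ∈ Xᶜ := mem_compl.2 fun h => hy.1 (mem_union_left _ h)
    have h2 : (mis y : ℝ) ≤ α * n := by
      by_contra hcon
      exact hy.1 (mem_union_right _ (mem_filter.2 ⟨h1, not_le.1 hcon⟩))
    refine le_trans ?_ h2
    have : ({x ∈ A j | ¬ G.Adj x y} : Finset V) ⊆
        ({b | b ∉ X ∧ c b ≠ c y ∧ ¬ G.Adj y b} : Finset V) := by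
      intro x hx
      rw [mem_filter, hmem] at hx
      simp only [mem_filter, mem_univ, true_and]
      refine ⟨fun h => hx.1.1 (mem_union_left _ h), ?_, fun h => hx.2 h.symm⟩
      rw [hx.1.2, hy.2]
      exact hij.symm
    exact_mod_cast card_le_card this

/-! ### Counting labelled copies -/

open scoped Classical in
/-- The labelled copies of `H` in `G`: the injective maps sending edges to edges. -/
noncomputable def labelledCopies {W V : Type*} [Fintype W] [Fintype V] (H : SimpleGraph W)
    (G : SimpleGraph V) : Finset (W → V) :=
  {f | Function.Injective f ∧ ∀ a b, H.Adj a b → G.Adj (f a) (f b)}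

theorem mem_labelledCopies {W V : Type*} [Fintype W] [Fintype V] {H : SimpleGraph W}
    {G : SimpleGraph V} {f : W → V} : f ∈ labelledCopies H G ↔
      Function.Injective f ∧ ∀ a b, H.Adj a b → G.Adj (f a) (f b) := by
  simp [labelledCopies]

theorem exists_iso_toSubgraph {W V : Type*} {H : SimpleGraph W} {G : SimpleGraph V}
    (f : SimpleGraph.Copy H G) (S : G.Subgraph) (h : f.toSubgraph = S) :
    ∃ e : H ≃g S.coe, ∀ x, (e x : V) = f x := by
  subst h
  exact ⟨f.isoToSubgraph, fun x => rfl⟩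

/-- Every unlabelled copy of `H` carries as many labellings as `H` has automorphisms. -/
theorem card_labelledCopies {W V : Type*} [Fintype W] [Fintype V] (H : SimpleGraph W)
    (G : SimpleGraph V) : #(labelledCopies H G) = N H G * Nat.card (H ≃g H) := by
  classical
  have : Finite (H ≃g H) := DFunLike.finite _
  have : Fintype (H ≃g H) := Fintype.ofFinite _
  have h1 : #(labelledCopies H G) = #(univ : Finset (SimpleGraph.Copy H G)) := by
    symm
    refine card_bij (fun f _ => (f : W → V)) (fun f _ => ?_) (fun f _ g _ h => ?_) (fun f hf => ?_)
    · exact mem_labelledCopies.2 ⟨f.injective, fun a b h => f.toHom.map_adj h⟩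
    · exact DFunLike.coe_injective h
    · obtain ⟨hinj, hadj⟩ := mem_labelledCopies.1 hf
      exact ⟨⟨⟨f, fun {a b} h => hadj a b h⟩, hinj⟩, mem_univ _, rfl⟩
  rw [h1, card_eq_sum_card_image SimpleGraph.Copy.toSubgraph, N,
    SimpleGraph.copyCount_eq_card_image_copyToSubgraph, ← smul_eq_mul, ← sum_const]
  refine sum_congr rfl fun S hS => ?_
  obtain ⟨f₀, -, rfl⟩ := mem_image.1 hS
  rw [Nat.card_eq_fintype_card, ← card_univ]
  symm
  refine card_bij (fun σ _ => f₀.comp σ.toCopy) (fun σ _ => ?_) (fun σ _ τ _ h => ?_)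
    (fun f hf => ?_)
  · rw [mem_filter]
    refine ⟨mem_univ _, SimpleGraph.Subgraph.ext ?_ ?_⟩
    · ext x
      simp only [SimpleGraph.Copy.toSubgraph, SimpleGraph.Subgraph.map_verts]
      constructor
      · rintro ⟨y, -, rfl⟩
        exact ⟨σ y, trivial, rfl⟩
      · rintro ⟨y, -, rfl⟩
        exact ⟨σ.symm y, trivial, by simp⟩
    · ext x y
      simp only [SimpleGraph.Copy.toSubgraph, SimpleGraph.Subgraph.map_adj]
      constructor
      · rintro ⟨a, b, h, rfl, rfl⟩
        exact ⟨σ a, σ b, σ.map_adj_iff.2 h, rfl, rfl⟩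
      · rintro ⟨a, b, h, rfl, rfl⟩
        exact ⟨σ.symm a, σ.symm b, σ.symm.map_adj_iff.2 h, by simp, by simp⟩
  · ext x
    have := DFunLike.congr_fun h x
    exact f₀.injective this
  · rw [mem_filter] at hf
    obtain ⟨e, he⟩ := exists_iso_toSubgraph f _ hf.2
    obtain ⟨e₀, he₀⟩ := exists_iso_toSubgraph f₀ _ rfl
    refine ⟨e.trans e₀.symm, mem_univ _, ?_⟩
    ext x
    change f₀ (e₀.symm (e x)) = f x
    rw [← he₀, RelIso.apply_symm_apply, he]

theorem card_aut_pos {W : Type*} [Finite W] (H : SimpleGraph W) : 0 < Nat.card (H ≃g H) := by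
  have : Finite (H ≃g H) := DFunLike.finite _
  exact Nat.card_pos_iff.2 ⟨⟨SimpleGraph.Iso.refl⟩, inferInstance⟩

theorem N_le_iff {W V V' : Type*} [Fintype W] [Fintype V] [Fintype V'] (H : SimpleGraph W)
    (G : SimpleGraph V) (G' : SimpleGraph V') :
    N H G ≤ N H G' ↔ #(labelledCopies H G) ≤ #(labelledCopies H G') := by
  rw [card_labelledCopies, card_labelledCopies, Nat.mul_le_mul_right_iff (card_aut_pos H)]

theorem N_le_of_iso {W V V' : Type*} [Fintype W] [Fintype V] [Fintype V'] (H : SimpleGraph W)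
    {G : SimpleGraph V} {G' : SimpleGraph V'} (e : G ≃g G') : N H G ≤ N H G' := by
  rw [N_le_iff]
  refine card_le_card_of_injOn (fun f => e ∘ f) (fun f hf => ?_) fun f _ g _ h => ?_
  · obtain ⟨h1, h2⟩ := mem_labelledCopies.1 hf
    exact mem_labelledCopies.2 ⟨e.injective.comp h1, fun a b h => e.map_adj_iff.2 (h2 a b h)⟩
  · exact e.injective.comp_left h

theorem N_congr {W V V' : Type*} [Fintype W] [Fintype V] [Fintype V'] (H : SimpleGraph W)
    {G : SimpleGraph V} {G' : SimpleGraph V'} (e : G ≃g G') : N H G = N H G' :=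
  (N_le_of_iso H e).antisymm (N_le_of_iso H e.symm)

open scoped Classical in
/-- If each value at `w'` conflicts with at most `q` elements of the list `S w`, then the proportion
of choice functions with a conflict between `w` and `w'` is at most `q / |S w|`. -/
theorem card_mul_card_filter_piFinset_le {W V : Type*} [Fintype W] (S : W → Finset V) {w w' : W}
    (hne : w ≠ w') (R : V → V → Prop) (q : ℕ) (hR : ∀ y ∈ S w', #{x ∈ S w | R x y} ≤ q) :
    #(S w) * #{f ∈ Fintype.piFinset S | R (f w) (f w')} ≤ q * #(Fintype.piFinset S) := by
  rw [← card_product]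
  have h1 : #((Fintype.piFinset S).sigma fun g => {z ∈ S w | R z (g w')}) ≤
      q * #(Fintype.piFinset S) := by
    rw [card_sigma, mul_comm]
    refine sum_le_card_nsmul _ _ q fun g hg => hR _ (Fintype.mem_piFinset.1 hg w')
  refine le_trans ?_ h1
  -- Exchange the value of `f` at `w` with the first component.
  refine card_le_card_of_injOn
    (fun p => (⟨Function.update p.2 w p.1, p.2 w⟩ : Σ _ : W → V, V)) ?_ ?_
  · rintro ⟨x, f⟩ hp
    simp only [coe_product, Set.mem_prod, mem_coe, mem_filter, Fintype.mem_piFinset] at hp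
    simp only [coe_sigma, Set.mem_sigma_iff, mem_coe, Fintype.mem_piFinset, mem_filter]
    refine ⟨fun a => ?_, hp.2.1 w, ?_⟩
    · by_cases ha : a = w
      · subst ha; simpa using hp.1
      · rw [Function.update_of_ne ha]; exact hp.2.1 a
    · rw [Function.update_of_ne hne.symm]; exact hp.2.2
  · rintro ⟨x, f⟩ - ⟨x', f'⟩ - h
    simp only [Sigma.mk.injEq, heq_eq_eq] at h
    obtain ⟨h1, h2⟩ := h
    have hx : x = x' := by simpa using congrFun h1 w
    have hf : f = f' := by
      funext a
      by_cases ha : a = w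
      · rw [ha, h2]
      · simpa [Function.update_of_ne ha] using congrFun h1 a
    rw [hx, hf]

open scoped Classical in
/-- If each list `S w` with `w ≠ w₀, w₁` is long compared to the number of choices in it that
conflict with a given choice elsewhere, then at least half of the choice functions are labelled
copies. -/
theorem prod_card_le_two_mul_card {W V : Type*} [Fintype W] [Fintype V] {H : SimpleGraph W}
    {G : SimpleGraph V} (S : W → Finset V) {w₀ w₁ : W} (hw : w₀ ≠ w₁)
    (hadj : ∀ x ∈ S w₀, ∀ y ∈ S w₁, G.Adj x y) (m : ℕ)
    (hcard : ∀ w, w ≠ w₀ → w ≠ w₁ → 2 * Fintype.card W ^ 2 * (m + 1) ≤ #(S w))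
    (hS : ∀ w, w ≠ w₀ → w ≠ w₁ → ∀ w', H.Adj w w' → ∀ y ∈ S w', #{x ∈ S w | ¬ G.Adj x y} ≤ m) :
    ∏ w, #(S w) ≤ 2 * #{f ∈ Fintype.piFinset S | f ∈ labelledCopies H G} := by
  rw [← Fintype.card_piFinset]
  set R : W → W → V → V → Prop := fun w w' x y => x = y ∨ (H.Adj w w' ∧ ¬ G.Adj x y) with hR
  set I : Finset (W × W) := {p | p.1 ≠ p.2 ∧ p.1 ≠ w₀ ∧ p.1 ≠ w₁} with hI
  set Bad : W × W → Finset (W → V) := fun p =>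
    {f ∈ Fintype.piFinset S | R p.1 p.2 (f p.1) (f p.2)} with hBad
  -- A choice function that is no labelled copy has a conflict involving some `w ≠ w₀, w₁`.
  have hsub : Fintype.piFinset S ⊆
      {f ∈ Fintype.piFinset S | f ∈ labelledCopies H G} ∪ I.biUnion Bad := by
    intro f hf
    by_contra hcon
    rw [mem_union, not_or, mem_biUnion] at hcon
    obtain ⟨h1, h2⟩ := hcon
    have h3 : ∀ w w', w ≠ w' → f w ≠ f w' ∧ (H.Adj w w' → G.Adj (f w) (f w')) := by
      have h4 : ∀ w w', w ≠ w' → w ≠ w₀ → w ≠ w₁ →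
          f w ≠ f w' ∧ (H.Adj w w' → G.Adj (f w) (f w')) := by
        intro w w' hne h0 h1
        by_contra hc
        refine h2 ⟨(w, w'), by simp [hI, hne, h0, h1], mem_filter.2 ⟨hf, ?_⟩⟩
        simp only [hR]
        by_contra hc'
        push Not at hc'
        exact hc ⟨hc'.1, hc'.2⟩
      have h5 : G.Adj (f w₀) (f w₁) :=
        hadj _ (Fintype.mem_piFinset.1 hf w₀) _ (Fintype.mem_piFinset.1 hf w₁)
      intro w w' hne
      by_cases h : w ≠ w₀ ∧ w ≠ w₁
      · exact h4 w w' hne h.1 h.2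
      by_cases h' : w' ≠ w₀ ∧ w' ≠ w₁
      · have := h4 w' w hne.symm h'.1 h'.2
        exact ⟨this.1.symm, fun hh => (this.2 hh.symm).symm⟩
      have hc : (w = w₀ ∧ w' = w₁) ∨ (w = w₁ ∧ w' = w₀) := by
        by_cases a : w = w₀ <;> by_cases b : w = w₁ <;> by_cases c : w' = w₀ <;>
          by_cases d : w' = w₁ <;> simp_all
      rcases hc with ⟨rfl, rfl⟩ | ⟨rfl, rfl⟩
      · exact ⟨h5.ne, fun _ => h5⟩
      · exact ⟨h5.ne', fun _ => h5.symm⟩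
    refine h1 (mem_filter.2 ⟨hf, mem_labelledCopies.2 ⟨fun a b hab => ?_, fun a b hab => ?_⟩⟩)
    · by_contra hne
      exact (h3 a b hne).1 hab
    · exact (h3 a b hab.ne).2 hab
  have hBadcard : ∀ p ∈ I, 2 * Fintype.card W ^ 2 * #(Bad p) ≤ #(Fintype.piFinset S) := by
    rintro ⟨w, w'⟩ hp
    simp only [hI, mem_filter, mem_univ, true_and] at hp
    have h0 : ∀ y ∈ S w', #{x ∈ S w | R w w' x y} ≤ m + 1 := by
      intro y hy
      simp only [hR]
      rw [filter_or]
      refine (card_union_le _ _).trans ?_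
      rw [add_comm m 1]
      refine add_le_add ?_ ?_
      · refine card_le_one.2 fun a ha b hb => ?_
        rw [(mem_filter.1 ha).2, (mem_filter.1 hb).2]
      · by_cases h : H.Adj w w'
        · simpa [h] using hS w hp.2.1 hp.2.2 w' h y hy
        · simp [h]
    have h1 : #(S w) * #(Bad (w, w')) ≤ (m + 1) * #(Fintype.piFinset S) := by
      convert card_mul_card_filter_piFinset_le S hp.1 (R w w') (m + 1)
        (fun y hy => by convert h0 y hy)
    have h2 := (Nat.mul_le_mul_right #(Bad (w, w')) (hcard w hp.2.1 hp.2.2)).trans h1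
    refine le_of_mul_le_mul_left ?_ (Nat.succ_pos m)
    calc (m + 1) * (2 * Fintype.card W ^ 2 * #(Bad (w, w')))
        = 2 * Fintype.card W ^ 2 * (m + 1) * #(Bad (w, w')) := by ring
      _ ≤ _ := h2
  have hWpos : 0 < Fintype.card W := Fintype.card_pos_iff.2 ⟨w₀⟩
  have hIcard : #I ≤ Fintype.card W ^ 2 := by
    refine (card_le_univ _).trans ?_
    rw [Fintype.card_prod, sq]
  have h1 : 2 * ∑ p ∈ I, #(Bad p) ≤ #(Fintype.piFinset S) := by
    refine le_of_mul_le_mul_left ?_ (pow_pos hWpos 2)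
    calc Fintype.card W ^ 2 * (2 * ∑ p ∈ I, #(Bad p))
        = ∑ p ∈ I, 2 * Fintype.card W ^ 2 * #(Bad p) := by rw [← mul_sum]; ring
      _ ≤ #I * #(Fintype.piFinset S) := by
          rw [← smul_eq_mul]; exact sum_le_card_nsmul _ _ _ hBadcard
      _ ≤ _ := Nat.mul_le_mul_right _ hIcard
  have h2 := (card_le_card hsub).trans (card_union_le _ _)
  have h3 : #(I.biUnion Bad) ≤ ∑ p ∈ I, #(Bad p) := card_biUnion_le
  omega

open scoped Classical in
theorem card_filter_two_values_le {W V : Type*} [Fintype W] [Fintype V] {a b : W} (hab : a ≠ b)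
    (v : V) (Z : Finset V) :
    #{f : W → V | f a = v ∧ f b ∈ Z} ≤ #Z * Fintype.card V ^ (Fintype.card W - 2) := by
  have h1 : ({f : W → V | f a = v ∧ f b ∈ Z} : Finset (W → V)) ⊆
      Fintype.piFinset fun w => if w = a then {v} else if w = b then Z else univ := by
    intro f hf
    rw [mem_filter] at hf
    rw [Fintype.mem_piFinset]
    intro w
    split_ifs with h h'
    · simp [h, hf.2.1]
    · rw [h']; exact hf.2.2
    · exact mem_univ _
  refine (card_le_card h1).trans ?_
  have hb : b ∈ (univ : Finset W).erase a := mem_erase.2 ⟨hab.symm, mem_univ _⟩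
  rw [Fintype.card_piFinset, ← mul_prod_erase _ _ (mem_univ a), ← mul_prod_erase _ _ hb]
  simp only [if_true, card_singleton, one_mul, hab.symm, if_false]
  refine Nat.mul_le_mul_left _ ?_
  have h2 : Fintype.card W - 2 = #((univ.erase a).erase b) := by
    rw [card_erase_of_mem hb, card_erase_of_mem (mem_univ _), card_univ]; omega
  rw [h2]
  refine prod_le_pow_card _ _ _ fun w hw => ?_
  exact card_le_univ _

/-! ### Changing the neighbourhood of a vertex -/

/-- The graph obtained from `G` by replacing the neighbourhood of `v` by `D` (minus `v`). -/
def rejoin {V : Type*} (G : SimpleGraph V) (v : V) (D : Finset V) : SimpleGraph V where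
  Adj x y := (x ≠ v ∧ y ≠ v ∧ G.Adj x y) ∨ (x = v ∧ y ≠ v ∧ y ∈ D) ∨ (y = v ∧ x ≠ v ∧ x ∈ D)
  symm := ⟨fun x y h => by
    rcases h with ⟨h1, h2, h3⟩ | h | h
    · exact .inl ⟨h2, h1, h3.symm⟩
    · exact .inr (.inr h)
    · exact .inr (.inl h)⟩
  loopless := ⟨fun x h => by
    rcases h with h | h | h
    · exact G.irrefl h.2.2
    · exact h.2.1 h.1
    · exact h.2.1 h.1⟩

/-- `F`-freeness is preserved if every few vertices of the new neighbourhood have further common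
neighbours in `G`: one of them can replace `v` in a copy of `F`. -/
theorem free_rejoin {U V : Type*} {F : SimpleGraph U} {G : SimpleGraph V} (hG : F.Free G) (v : V)
    (D : Finset V)
    (h : ∀ f : U → V, ∃ w, (∀ u, w ≠ f u) ∧ ∀ u, f u ∈ D → f u ≠ v → G.Adj w (f u)) :
    F.Free (rejoin G v D) := by
  classical
  rintro ⟨g⟩
  obtain ⟨w, hw1, hw2⟩ := h g
  refine hG (isContained_of_injective_hom (fun u => if g u = v then w else g u) ?_ ?_)
  · intro a b hab
    simp only at hab
    split_ifs at hab with h1 h2 h2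
    · exact g.injective (h1.trans h2.symm)
    · exact absurd hab (hw1 b)
    · exact absurd hab.symm (hw1 a)
    · exact g.injective hab
  · intro a b hab
    have := g.toHom.map_adj hab
    rcases this with ⟨h1, h2, h3⟩ | ⟨h1, h2, h3⟩ | ⟨h1, h2, h3⟩
    · change g a ≠ v at h1
      change g b ≠ v at h2
      simp only [h1, h2, if_false]
      exact h3
    · change g a = v at h1
      change g b ≠ v at h2
      simp only [h1, h2, if_true, if_false]
      exact hw2 b h3 h2
    · change g b = v at h1
      change g a ≠ v at h2
      simp only [h1, h2, if_true, if_false]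
      exact (hw2 a h3 h2).symm

/-- A colouring of `H` can be normalized to have prescribed distinct colours on an edge. -/
theorem exists_coloring_of_adj {W : Type*} {H : SimpleGraph W} {r : ℕ} (hH : H.Colorable r)
    {w₀ w₁ : W} (hw : H.Adj w₀ w₁) {i j : Fin r} (hij : i ≠ j) :
    ∃ ψ : W → Fin r, (∀ a b, H.Adj a b → ψ a ≠ ψ b) ∧ ψ w₀ = i ∧ ψ w₁ = j := by
  obtain ⟨c⟩ := hH
  have h1 : Equiv.swap (c w₀) i (c w₁) ≠ i := by
    intro h
    refine c.valid hw ((Equiv.swap (c w₀) i).injective ?_)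
    rw [h, Equiv.swap_apply_left]
  refine ⟨fun w => Equiv.swap (Equiv.swap (c w₀) i (c w₁)) j (Equiv.swap (c w₀) i (c w)),
    fun a b hab he => ?_, ?_, ?_⟩
  · exact c.valid hab ((Equiv.swap (c w₀) i).injective ((Equiv.swap _ j).injective he))
  · simp only [Equiv.swap_apply_left]
    exact Equiv.swap_apply_of_ne_of_ne h1.symm hij
  · simp only [Equiv.swap_apply_left]

open scoped Classical in
/-- The labelled copies of `H` lost by passing to `rejoin G v D` use an edge from `v` to one of its
neighbours outside `D`. -/
theorem card_labelledCopies_sdiff_rejoin_le {W V : Type*} [Fintype W] [Fintype V]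
    (H : SimpleGraph W) (G : SimpleGraph V) (v : V) (D : Finset V) :
    #(labelledCopies H G \ labelledCopies H (rejoin G v D)) ≤
      Fintype.card W ^ 2 * (#{x | G.Adj v x ∧ x ∉ D} *
        Fintype.card V ^ (Fintype.card W - 2)) := by
  set Z : Finset V := {x | G.Adj v x ∧ x ∉ D} with hZ
  have hsub : labelledCopies H G \ labelledCopies H (rejoin G v D) ⊆
      ({p : W × W | p.1 ≠ p.2} : Finset (W × W)).biUnion
        fun p => {f : W → V | f p.1 = v ∧ f p.2 ∈ Z} := by
    intro f hf
    rw [mem_sdiff, mem_labelledCopies, mem_labelledCopies, not_and] at hf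
    obtain ⟨⟨hinj, hadj⟩, hf⟩ := hf
    have hf := hf hinj
    push Not at hf
    obtain ⟨a, b, hab, hnot⟩ := hf
    have hG := hadj a b hab
    rw [mem_biUnion]
    by_cases ha : f a = v
    · refine ⟨(a, b), by simp [hab.ne], ?_⟩
      have hb : f b ≠ v := fun h => hG.ne (ha.trans h.symm)
      simp only [mem_filter, mem_univ, true_and, hZ]
      exact ⟨ha, ha ▸ hG, fun h => hnot (.inr (.inl ⟨ha, hb, h⟩))⟩
    · by_cases hb : f b = v
      · refine ⟨(b, a), by simp [hab.ne'], ?_⟩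
        simp only [mem_filter, mem_univ, true_and, hZ]
        exact ⟨hb, hb ▸ hG.symm, fun h => hnot (.inr (.inr ⟨hb, ha, h⟩))⟩
      · exact absurd (.inl ⟨ha, hb, hG⟩) hnot
  refine (card_le_card hsub).trans ((card_biUnion_le_card_mul _ _ _ fun p hp =>
    card_filter_two_values_le (mem_filter.1 hp).2 v Z).trans ?_)
  refine Nat.mul_le_mul_right _ ((card_le_univ _).trans ?_)
  rw [Fintype.card_prod, sq]

open scoped Classical in
/-- A missing edge from `v` to a part `A j` with `j ≠ i` lies, after joining `v` to all parts but
`A i`, in about `n ^ (|W| - 2)` labelled copies of `H`. -/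
theorem card_nonadj_mul_le {W V : Type*} [Fintype W] [Fintype V]
    {H : SimpleGraph W} {G : SimpleGraph V} {r : ℕ} (hH : H.Colorable r) {w₀ w₁ : W}
    (hw : H.Adj w₀ w₁) (A : Fin r → Finset V) (m ℓ : ℕ)
    (hA : ∀ i j, i ≠ j → ∀ y ∈ A i, #{x ∈ A j | ¬ G.Adj x y} ≤ m)
    (hℓ : ∀ i, ℓ + 1 ≤ #(A i)) (hm : 2 * Fintype.card W ^ 2 * (m + 1) ≤ ℓ)
    (v : V) {i j : Fin r} (hij : i ≠ j) :
    #{x ∈ A j | x ≠ v ∧ ¬ G.Adj v x} * ℓ ^ (Fintype.card W - 2) ≤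
      2 * #(labelledCopies H (rejoin G v ((univ.erase i).biUnion A)) \ labelledCopies H G) := by
  obtain ⟨ψ, hψ, h0, h1⟩ := exists_coloring_of_adj hH hw hij
  set D : Finset V := (univ.erase i).biUnion A with hD
  have hmemD : ∀ k, k ≠ i → ∀ x ∈ A k, x ∈ D := fun k hk x hx =>
    mem_biUnion.2 ⟨k, mem_erase.2 ⟨hk, mem_univ _⟩, hx⟩
  set T : Finset V := {x ∈ A j | x ≠ v ∧ ¬ G.Adj v x} with hT
  set S : W → Finset V := fun w => if w = w₀ then {v} else if w = w₁ then T else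
    (A (ψ w)).erase v with hS
  have hS0 : S w₀ = {v} := by simp [hS]
  have hS1 : S w₁ = T := by simp [hS, hw.ne']
  have hS2 : ∀ w, w ≠ w₀ → w ≠ w₁ → S w = (A (ψ w)).erase v := by
    intro w ha hb; simp [hS, ha, hb]
  have hS3 : ∀ w, w ≠ w₀ → S w ⊆ (A (ψ w)).erase v := by
    intro w ha
    by_cases hb : w = w₁
    · subst hb
      rw [hS1, h1]
      intro x hx
      rw [mem_filter] at hx
      exact mem_erase.2 ⟨hx.2.1, hx.1⟩
    · rw [hS2 w ha hb]
  have hcardS : ∀ w, w ≠ w₀ → w ≠ w₁ → ℓ ≤ #(S w) := by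
    intro w ha hb
    rw [hS2 w ha hb]
    have := pred_card_le_card_erase (s := A (ψ w)) (a := v)
    have := hℓ (ψ w)
    omega
  have hprod := prod_card_le_two_mul_card (H := H) (G := rejoin G v D) S hw.ne
    (fun x hx y hy => by
      rw [hS0, mem_singleton] at hx
      rw [hS1, mem_filter] at hy
      exact .inr (.inl ⟨hx, hy.2.1, hmemD j hij.symm y hy.1⟩)) m
    (fun w ha hb => hm.trans (hcardS w ha hb))
    (fun w ha hb w' hww' y hy => by
      rw [hS2 w ha hb]
      by_cases hw' : w' = w₀
      · subst hw'
        rw [hS0, mem_singleton] at hy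
        rw [filter_false_of_mem]
        · simp
        · intro x hx
          rw [mem_erase] at hx
          exact not_not.2 (.inr (.inr ⟨hy, hx.1,
            hmemD (ψ w) (fun h => hψ w w' hww' (h.trans h0.symm)) x hx.2⟩))
      · have hy' := mem_erase.1 (hS3 w' hw' hy)
        refine le_trans (card_le_card fun x hx => ?_)
          (hA (ψ w') (ψ w) (hψ w w' hww').symm y hy'.2)
        rw [mem_filter, mem_erase] at hx
        exact mem_filter.2 ⟨hx.1.2, fun h => hx.2 (.inl ⟨hx.1.1, hy'.1, h⟩)⟩)
  have hsub : {f ∈ Fintype.piFinset S | f ∈ labelledCopies H (rejoin G v D)} ⊆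
      labelledCopies H (rejoin G v D) \ labelledCopies H G := by
    intro f hf
    rw [mem_filter, Fintype.mem_piFinset] at hf
    refine mem_sdiff.2 ⟨hf.2, fun h => ?_⟩
    have h2 := (mem_labelledCopies.1 h).2 w₀ w₁ hw
    have h3 : f w₀ = v := by simpa [hS0] using hf.1 w₀
    have h4 := hf.1 w₁
    rw [hS1, mem_filter] at h4
    rw [h3] at h2
    exact h4.2.2 h2
  refine le_trans ?_ (hprod.trans (Nat.mul_le_mul_left 2 (card_le_card hsub)))
  have hmem : w₁ ∈ (univ : Finset W).erase w₀ := mem_erase.2 ⟨hw.ne', mem_univ _⟩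
  rw [← mul_prod_erase _ _ (mem_univ w₀), ← mul_prod_erase _ _ hmem, hS0, hS1, card_singleton,
    one_mul]
  refine Nat.mul_le_mul_left _ ?_
  have hc : Fintype.card W - 2 = #((univ.erase w₀).erase w₁) := by
    rw [card_erase_of_mem hmem, card_erase_of_mem (mem_univ _), card_univ]; omega
  rw [hc]
  refine pow_card_le_prod _ _ _ fun w hw => ?_
  rw [mem_erase, mem_erase] at hw
  exact hcardS w hw.2.1 hw.1

open scoped Classical in
/-- If joining `v` to all parts but `A i` does not increase the number of copies of `H`, then the
number of neighbours that `v` lacks in another part is bounded by the number of its neighbours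
outside these parts. -/
theorem card_nonadj_le {W V : Type*} [Fintype W] [Fintype V]
    {H : SimpleGraph W} {G : SimpleGraph V} {r : ℕ} (hH : H.Colorable r) {w₀ w₁ : W}
    (hw : H.Adj w₀ w₁) (A : Fin r → Finset V) (m ℓ C : ℕ)
    (hA : ∀ i j, i ≠ j → ∀ y ∈ A i, #{x ∈ A j | ¬ G.Adj x y} ≤ m)
    (hℓ : ∀ i, ℓ + 1 ≤ #(A i)) (hm : 2 * Fintype.card W ^ 2 * (m + 1) ≤ ℓ)
    (hC : Fintype.card V ≤ C * ℓ) (v : V) {i j : Fin r} (hij : i ≠ j)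
    (hle : N H (rejoin G v ((univ.erase i).biUnion A)) ≤ N H G) :
    #{x ∈ A j | x ≠ v ∧ ¬ G.Adj v x} ≤ 2 * Fintype.card W ^ 2 * C ^ (Fintype.card W - 2) *
      #{x | G.Adj v x ∧ x ∉ (univ.erase i).biUnion A} := by
  have h1 := card_nonadj_mul_le hH hw A m ℓ hA hℓ hm v hij
  have h2 := card_labelledCopies_sdiff_rejoin_le H G v ((univ.erase i).biUnion A)
  rw [N_le_iff] at hle
  set L := labelledCopies H G
  set L' := labelledCopies H (rejoin G v ((univ.erase i).biUnion A)) with hL'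
  have h3 : #(L' \ L) ≤ #(L \ L') := by
    have ha := card_sdiff_add_card_inter L L'
    have hb := card_sdiff_add_card_inter L' L
    rw [inter_comm] at hb
    omega
  have hWpos : 0 < Fintype.card W := Fintype.card_pos_iff.2 ⟨w₀⟩
  have hℓpos : 0 < ℓ := lt_of_lt_of_le (by positivity) hm
  refine le_of_mul_le_mul_right ?_ (pow_pos hℓpos (Fintype.card W - 2))
  refine h1.trans ((Nat.mul_le_mul_left 2 (h3.trans h2)).trans ?_)
  have h4 : Fintype.card V ^ (Fintype.card W - 2) ≤
      C ^ (Fintype.card W - 2) * ℓ ^ (Fintype.card W - 2) := by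
    rw [← mul_pow]; exact Nat.pow_le_pow_left hC _
  refine (Nat.mul_le_mul_left 2 (Nat.mul_le_mul_left _ (Nat.mul_le_mul_left _ h4))).trans
    (le_of_eq ?_)
  ring

/-! ### From almost `r`-partite to complete multipartite -/

open scoped Classical in
/-- Suppose that every vertex with few neighbours in one of the almost completely joined parts
`A i` is joined to almost all vertices of the other parts. Then an `F`-free graph is `r`-colourable,
each part staying within one colour class. -/
theorem exists_coloring_of_card_nonadj_le {U V : Type*} [Fintype U] {F : SimpleGraph U}
    {G : SimpleGraph V} {r : ℕ} {u₀ v₀ : U} {φ : U → Fin r} (hφ : IsCriticalColoring F u₀ v₀ φ)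
    (hG : F.Free G) (A : Fin r → Finset V) (m d : ℕ)
    (hA : ∀ i j, i ≠ j → ∀ y ∈ A i, #{x ∈ A j | ¬ G.Adj x y} ≤ m)
    (hd : ∀ v i, #{x ∈ A i | G.Adj v x} ≤ Fintype.card U * (m + 1) →
      ∀ j, i ≠ j → #{x ∈ A j | x ≠ v ∧ ¬ G.Adj v x} ≤ d)
    (hdA : ∀ i, 2 * (d + 1) + Fintype.card U * (m + 1) < #(A i))
    (hmA : ∀ i, m + Fintype.card U * (m + 1) < #(A i)) :
    ∃ κ : V → Fin r, (∀ a b, G.Adj a b → κ a ≠ κ b) ∧ ∀ i, ∀ v ∈ A i, κ v = i := by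
  have hκ : ∀ v, ∃ i, #{x ∈ A i | G.Adj v x} ≤ Fintype.card U * (m + 1) := by
    intro v
    by_contra hcon
    push Not at hcon
    exact hG (isContained_of_many_neighbors hφ A m hA v hcon)
  choose κ hκ using hκ
  have hnon : ∀ v j, κ v ≠ j → #{x ∈ A j | ¬ G.Adj v x} ≤ d + 1 := by
    intro v j hj
    have h1 : ({x ∈ A j | ¬ G.Adj v x} : Finset V) ⊆
        insert v ({x ∈ A j | x ≠ v ∧ ¬ G.Adj v x} : Finset V) := by
      intro x hx
      rw [mem_filter] at hx
      rw [mem_insert, mem_filter]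
      by_cases hxv : x = v
      · exact .inl hxv
      · exact .inr ⟨hx.1, hxv, hx.2⟩
    have h2 := (card_le_card h1).trans (card_insert_le _ _)
    have := hd v (κ v) (hκ v) j hj
    omega
  refine ⟨κ, fun a b hab he => ?_, fun i v hv => ?_⟩
  · refine hG (isContained_of_adj_of_common_neighbors hφ A m hA a b hab (κ a) ?_ fun j hj => ?_)
    · have := hmA (κ a)
      omega
    · have h1 : A j ⊆ ({x ∈ A j | G.Adj a x ∧ G.Adj b x} : Finset V) ∪
          (({x ∈ A j | ¬ G.Adj a x} : Finset V) ∪ ({x ∈ A j | ¬ G.Adj b x} : Finset V)) := by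
        intro x hx
        simp only [mem_union, mem_filter, hx, true_and]
        tauto
      have h2 := (card_le_card h1).trans (card_union_le _ _)
      have h3 := card_union_le ({x ∈ A j | ¬ G.Adj a x} : Finset V)
        ({x ∈ A j | ¬ G.Adj b x} : Finset V)
      have h4 := hnon a j hj.symm
      have h5 := hnon b j (he ▸ hj.symm)
      have h6 := hdA j
      omega
  · by_contra hne
    have h1 := hA i (κ v) (Ne.symm hne) v hv
    have h2 := card_filter_add_card_filter_not (s := A (κ v)) (fun x => G.Adj x v)
    have h3 := hκ v
    simp only [SimpleGraph.adj_comm G v] at h3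
    have h4 := hmA (κ v)
    omega

open scoped Classical in
/-- A dense `F`-free graph with the largest number of copies of `H` is `r`-colourable, with large
colour classes. -/
theorem exists_coloring_of_forall_N_le {U W : Type*} [Fintype U] [Fintype W] {F : SimpleGraph U}
    {H : SimpleGraph W} {r : ℕ} {u₀ v₀ : U} {φ : U → Fin r} (hφ : IsCriticalColoring F u₀ v₀ φ)
    (hF : F.Colorable (r + 1)) (hr : 2 ≤ r) (hH : H.Colorable r) {w₀ w₁ : W}
    (hw : H.Adj w₀ w₁) :
    ∃ ε > 0, ∃ n₀ : ℕ, ∀ {V : Type*} [Fintype V] (G : SimpleGraph V), F.Free G →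
      (∀ G' : SimpleGraph V, F.Free G' → N H G' ≤ N H G) → n₀ ≤ Fintype.card V →
      (1 - 1 / r - ε) * (Fintype.card V : ℝ) ^ 2 ≤ twiceEdges G univ →
      ∃ κ : V → Fin r, (∀ a b, G.Adj a b → κ a ≠ κ b) ∧
        ∀ i, Fintype.card W < #{v | κ v = i} := by
  set u := Fintype.card U with hu
  set h := Fintype.card W with hh
  have hu1 : 1 ≤ u := Fintype.card_pos_iff.2 ⟨u₀⟩
  have hh1 : 1 ≤ h := Fintype.card_pos_iff.2 ⟨w₀⟩
  set M : ℕ := 2 * h ^ 2 * (4 * r) ^ (h - 2) with hM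
  have hM1 : 1 ≤ M := Nat.succ_le_of_lt (by positivity)
  -- `Q` bounds the constants `M * u`, `u`, `h ^ 2` by which `α * n` gets multiplied below.
  set Q : ℕ := M * u * h ^ 2 with hQ
  have hQpos : (0 : ℝ) < Q := by
    have : 0 < Q := by positivity
    exact_mod_cast this
  have hr0 : (0 : ℝ) < r := by
    have : 0 < r := by omega
    exact_mod_cast this
  have hM0 : (0 : ℝ) < M := by exact_mod_cast hM1
  set α : ℝ := 1 / (64 * r * Q) with hα
  set γ : ℝ := 1 / (32 * r * M) with hγ
  obtain ⟨ε, hε, n₀, hn₀⟩ := exists_almost_complete_parts hφ hF hr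
    (α := α) (γ := γ) (by positivity) (by positivity)
  refine ⟨ε, hε, max n₀ (64 * r * Q), fun {V} _ G hG hmax hn he => ?_⟩
  obtain ⟨A, hrest, hlarge, hA⟩ := hn₀ G hG ((le_max_left _ _).trans hn) he
  have hnQ : (64 * r * Q : ℝ) ≤ Fintype.card V := by exact_mod_cast (le_max_right _ _).trans hn
  have hCℓ : Fintype.card V ≤ 4 * r * ⌈(Fintype.card V : ℝ) / (4 * r)⌉₊ := by
    have h1 := Nat.le_ceil ((Fintype.card V : ℝ) / (4 * r))
    rw [div_le_iff₀ (by positivity), mul_comm] at h1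
    exact_mod_cast h1
  set n : ℝ := (Fintype.card V : ℝ) with hndef
  -- All quantities are compared with `x`; the parts `A i` have size at least `32 * x`.
  set x : ℝ := n / (64 * r) with hx
  have hQx : (Q : ℝ) ≤ x := by
    rw [hx, le_div_iff₀ (by positivity)]; linarith
  have hx0 : 0 < x := hQpos.trans_le hQx
  have hle : ∀ y : ℕ, y ≤ Q → (y : ℝ) ≤ x := fun y hy => le_trans (by exact_mod_cast hy) hQx
  have hMu : M * u ≤ Q := Nat.le_mul_of_pos_right _ (by positivity)
  have huQ : u ≤ Q := (Nat.le_mul_of_pos_left u hM1).trans hMu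
  have hhQ : h ^ 2 ≤ Q := Nat.le_mul_of_pos_left _ (by positivity)
  have h1Q : 1 ≤ Q := hu1.trans huQ
  have hx1 : 1 ≤ x := by simpa using hle 1 h1Q
  have hαn : α * n = x / Q := by rw [hα, hx]; field_simp
  have hleα : ∀ y : ℕ, y ≤ Q → (y : ℝ) * (α * n) ≤ x := by
    intro y hy
    have : (y : ℝ) ≤ Q := by exact_mod_cast hy
    rw [hαn, ← mul_div_assoc, div_le_iff₀ hQpos]
    nlinarith
  set m : ℕ := ⌊α * n⌋₊ with hm
  have hmle : (m : ℝ) ≤ α * n := Nat.floor_le (by positivity)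
  have hmul : ∀ y : ℕ, y ≤ Q → (y : ℝ) * (m + 1) ≤ 2 * x := by
    intro y hy
    have h1 := hle y hy
    have h2 := hleα y hy
    have h3 : (y : ℝ) * m ≤ y * (α * n) := by gcongr
    linarith
  have hA' : ∀ i j, i ≠ j → ∀ y ∈ A i, #{x ∈ A j | ¬ G.Adj x y} ≤ m := fun i j hij y hy =>
    Nat.le_floor (hA i j hij y hy)
  have hlarge' : ∀ i, 32 * x ≤ #(A i) := by
    intro i
    have : 32 * x = n / (2 * r) := by rw [hx]; field_simp; ring
    rw [this]; exact hlarge i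
  set ℓ : ℕ := ⌈n / (4 * r)⌉₊ with hℓ
  have h16 : n / (4 * r) = 16 * x := by rw [hx]; field_simp; ring
  have hℓ1 : 16 * x ≤ ℓ := by rw [← h16]; exact Nat.le_ceil _
  have hℓ2 : (ℓ : ℝ) < 16 * x + 1 := by rw [← h16]; exact Nat.ceil_lt_add_one (by positivity)
  set d : ℕ := ⌊4 * x⌋₊ with hd
  have hdle : (d : ℝ) ≤ 4 * x := Nat.floor_le (by positivity)
  have hum := hmul u huQ
  -- A vertex of `A i` adjacent to all relevant vertices can replace `v` in a copy of `F`.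
  have hrejoin : ∀ v i, F.Free (rejoin G v ((univ.erase i).biUnion A)) := by
    intro v i
    refine free_rejoin hG v _ fun f => ?_
    obtain ⟨w, -, hw1, hw2⟩ := exists_common_neighbor (G := G) (A i) f
      (fun a => f a ∈ (univ.erase i).biUnion A) m
      (by
        have : ((u * (m + 1) : ℕ) : ℝ) < #(A i) := by
          push_cast
          linarith [hlarge' i]
        exact_mod_cast this)
      (fun a ha => by
        obtain ⟨j, hj, hfa⟩ := mem_biUnion.1 ha
        exact hA' j i (mem_erase.1 hj).1 _ hfa)
    exact ⟨w, hw1, fun a ha _ => hw2 a ha⟩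
  obtain ⟨κ, hκ1, hκ2⟩ := exists_coloring_of_card_nonadj_le hφ hG A m d hA'
    (fun v i hvi j hij => by
      have h1 := card_nonadj_le hH hw A m ℓ (4 * r) hA'
        (fun i => by
          have : ((ℓ + 1 : ℕ) : ℝ) ≤ #(A i) := by
            push_cast
            linarith [hlarge' i]
          exact_mod_cast this)
        (by
          have h2 := hmul (h ^ 2) hhQ
          have : ((2 * h ^ 2 * (m + 1) : ℕ) : ℝ) ≤ ℓ := by
            push_cast at h2 ⊢
            linarith
          exact_mod_cast this) hCℓ v hij (hmax _ (hrejoin v i))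
      refine h1.trans (Nat.le_floor ?_)
      have h2 : (#{x | G.Adj v x ∧ x ∉ (univ.erase i).biUnion A} : ℝ) ≤
          u * (m + 1) + γ * n := by
        have hsub : ({x | G.Adj v x ∧ x ∉ (univ.erase i).biUnion A} : Finset V) ⊆
            ({x ∈ A i | G.Adj v x} : Finset V) ∪ (univ.biUnion A)ᶜ := by
          intro y hy
          simp only [mem_filter, mem_univ, true_and, mem_biUnion, mem_erase, not_exists,
            not_and] at hy
          rw [mem_union, mem_filter, mem_compl, mem_biUnion]
          by_cases hyi : y ∈ A i
          · exact .inl ⟨hyi, hy.1⟩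
          · refine .inr ?_
            rintro ⟨j, -, hyj⟩
            by_cases hji : j = i
            · exact hyi (hji ▸ hyj)
            · exact hy.2 j ⟨hji, trivial⟩ hyj
        have h3 := (card_le_card hsub).trans (card_union_le _ _)
        have h4 : (#{x | G.Adj v x ∧ x ∉ (univ.erase i).biUnion A} : ℝ) ≤
            #{x ∈ A i | G.Adj v x} + #(univ.biUnion A)ᶜ := by exact_mod_cast h3
        have h5 : (#{x ∈ A i | G.Adj v x} : ℝ) ≤ u * (m + 1) := by exact_mod_cast hvi
        linarith
      have h3 : (M : ℝ) * (γ * n) = 2 * x := by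
        rw [hγ, hx]; field_simp; ring
      have h4 := hmul (M * u) hMu
      push_cast at h4
      have h5 := mul_le_mul_of_nonneg_left h2 hM0.le
      rw [← hM, Nat.cast_mul]
      linarith)
    (fun i => by
      have : ((2 * (d + 1) + u * (m + 1) : ℕ) : ℝ) < #(A i) := by
        push_cast
        linarith [hlarge' i]
      exact_mod_cast this)
    (fun i => by
      have h1 := hmul 1 h1Q
      have : ((m + u * (m + 1) : ℕ) : ℝ) < #(A i) := by
        push_cast at h1 ⊢
        linarith [hlarge' i]
      exact_mod_cast this)
  refine ⟨κ, hκ1, fun i => ?_⟩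
  have h1 : A i ⊆ ({v | κ v = i} : Finset V) := fun v hv => by
    rw [mem_filter]; exact ⟨mem_univ _, hκ2 i v hv⟩
  refine lt_of_lt_of_le ?_ (card_le_card h1)
  have h2 := hle h ((Nat.le_self_pow two_ne_zero h).trans hhQ)
  have : ((h : ℕ) : ℝ) < #(A i) := by linarith [hlarge' i]
  exact_mod_cast this

open scoped Classical in
/-- If adding a missing edge between two large colour classes cannot increase the number of copies
of `H`, then the graph is complete multipartite. -/
theorem eq_of_N_le {V W : Type*} [Fintype V] [Fintype W] {H : SimpleGraph W}
    {G K : SimpleGraph V} {r : ℕ} (hH : H.Colorable r) {w₀ w₁ : W} (hw : H.Adj w₀ w₁)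
    (κ : V → Fin r) (hK : ∀ a b, K.Adj a b ↔ κ a ≠ κ b) (hκ : ∀ a b, G.Adj a b → κ a ≠ κ b)
    (hlarge : ∀ i, Fintype.card W < #{v | κ v = i})
    (hle : N H K ≤ N H G) : G = K := by
  have hGK : G ≤ K := fun a b hab => (hK a b).2 (hκ a b hab)
  refine le_antisymm hGK fun a b hab => ?_
  by_contra hGab
  obtain ⟨ψ, hψ, h0, h1⟩ := exists_coloring_of_adj hH hw ((hK a b).1 hab)
  set S : W → Finset V := fun w => if w = w₀ then {a} else if w = w₁ then {b} else
    ({v | κ v = ψ w} : Finset V) with hS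
  have hSψ : ∀ w, ∀ y ∈ S w, κ y = ψ w := by
    intro w y hy
    simp only [hS] at hy
    split_ifs at hy with ha hb
    · rw [mem_singleton] at hy; rw [hy, ha, h0]
    · rw [mem_singleton] at hy; rw [hy, hb, h1]
    · exact (mem_filter.1 hy).2
  have hadjS : ∀ w w', H.Adj w w' → ∀ x ∈ S w, ∀ y ∈ S w', K.Adj x y := by
    intro w w' h x hx y hy
    rw [hK, hSψ w x hx, hSψ w' y hy]
    exact hψ w w' h
  have hS0 : S w₀ = {a} := by simp [hS]
  have hS1 : S w₁ = {b} := by simp [hS, hw.ne']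
  obtain ⟨f, hfS, hinj, hadj⟩ := exists_injective_hom (F := H) (G := K) {w₀, w₁} S 0
    (by simp [hS0, hS1])
    (fun f hf => by
      have hf0 : f w₀ = a := by simpa [hS0] using hf w₀
      have hf1 : f w₁ = b := by simpa [hS1] using hf w₁
      refine ⟨?_, fun u _ w _ h => hadjS u w h _ (hf u) _ (hf w)⟩
      rw [coe_pair, Set.injOn_pair]
      intro h
      rw [hf0, hf1] at h
      exact absurd h hab.ne)
    (fun w hw' => by
      simp only [mem_insert, mem_singleton, not_or] at hw'
      simpa [hS, hw'.1, hw'.2] using hlarge (ψ w))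
    (fun u _ w huw y hy => by
      refine (card_eq_zero.2 (filter_eq_empty_iff.2 fun x hx => ?_)).le
      exact not_not.2 (hadjS u w huw x hx y hy))
  have hf0 : f w₀ = a := by simpa [hS0] using hfS w₀
  have hf1 : f w₁ = b := by simpa [hS1] using hfS w₁
  have hlt : #(labelledCopies H G) < #(labelledCopies H K) := by
    refine card_lt_card ⟨fun g hg => ?_, fun hsub => ?_⟩
    · obtain ⟨hg1, hg2⟩ := mem_labelledCopies.1 hg
      exact mem_labelledCopies.2 ⟨hg1, fun c c' hc => hGK (hg2 c c' hc)⟩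
    · have := (mem_labelledCopies.1 (hsub (mem_labelledCopies.2 ⟨hinj, hadj⟩))).2 w₀ w₁ hw
      rw [hf0, hf1] at this
      exact hGab this
  rw [N_le_iff] at hle
  omega

open scoped Classical in
theorem nonempty_completePartite_iso {V : Type*} [Fintype V] {r : ℕ} (κ : V → Fin r) :
    Nonempty (completePartite (fun i => #{v | κ v = i}) ≃g (⊤ : SimpleGraph (Fin r)).comap κ) := by
  have e : ∀ i, Nonempty (Fin #{v | κ v = i} ≃ {v // κ v = i}) := fun i =>
    ⟨(Fintype.equivFinOfCardEq (Fintype.card_subtype _)).symm⟩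
  refine ⟨⟨(Equiv.sigmaCongrRight fun i => (e i).some).trans (Equiv.sigmaFiberEquiv κ), ?_⟩⟩
  rintro ⟨i, x⟩ ⟨j, y⟩
  have hx : ∀ i x, κ (((Equiv.sigmaCongrRight fun i => (e i).some).trans
      (Equiv.sigmaFiberEquiv κ)) ⟨i, x⟩) = i := fun i x => ((e i).some x).2
  simp only [SimpleGraph.comap_adj, SimpleGraph.top_adj, hx]

theorem twiceEdges_univ_eq {V : Type*} [Fintype V] (G : SimpleGraph V) :
    twiceEdges G univ = 2 * e G := by
  classical
  have h1 : e G = #G.edgeFinset := by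
    rw [e, SimpleGraph.edgeFinset, Set.ncard_eq_toFinset_card']
  rw [h1, ← SimpleGraph.sum_degrees_eq_twice_card_edges, twiceEdges]
  refine sum_congr rfl fun v _ => ?_
  rw [← SimpleGraph.card_neighborFinset_eq_degree, degIn]
  congr 1
  ext w
  simp

/-- The Turán graph has at least `(1 - 1 / r - o(1)) n ^ 2 / 2` edges. -/
theorem eventually_le_twice_e_turanGraph {r : ℕ} (hr : 1 ≤ r) {ε : ℝ} (hε : 0 < ε) :
    ∀ᶠ n : ℕ in Filter.atTop,
      (1 - 1 / r - ε) * (n : ℝ) ^ 2 ≤ 2 * (e (SimpleGraph.turanGraph n r) : ℝ) := by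
  obtain ⟨n₀, hn₀⟩ := exists_nat_gt (((r : ℝ) ^ 2 + 2) / ε)
  filter_upwards [Filter.eventually_ge_atTop (max n₀ 1)] with n hn
  have hr0 : (0 : ℝ) < r := by exact_mod_cast hr
  have hn1 : (1 : ℝ) ≤ n := by exact_mod_cast (le_max_right _ _).trans hn
  have hn0 : (n₀ : ℝ) ≤ n := by exact_mod_cast (le_max_left _ _).trans hn
  have h1 : (r : ℝ) ^ 2 + 2 ≤ ε * (n : ℝ) ^ 2 := by
    rw [div_lt_iff₀ hε] at hn₀
    have h : (n₀ : ℝ) * ε ≤ n * ε := by gcongr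
    nlinarith [mul_le_mul_of_nonneg_left hn1 (by positivity : 0 ≤ ε * (n : ℝ))]
  have h2 : e (SimpleGraph.turanGraph n r) = #(SimpleGraph.turanGraph n r).edgeFinset := by
    rw [e, SimpleGraph.edgeFinset, Set.ncard_eq_toFinset_card']
  have hmod : n % r < r := Nat.mod_lt _ hr
  rw [h2, SimpleGraph.card_edgeFinset_turanGraph]
  have h3 := Nat.lt_div_mul_add (a := (n ^ 2 - (n % r) ^ 2) * (r - 1)) (b := 2 * r) (by omega)
  set q := (n ^ 2 - (n % r) ^ 2) * (r - 1) / (2 * r)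
  have h4 : (((n ^ 2 - (n % r) ^ 2) * (r - 1) : ℕ) : ℝ) < q * (2 * r) + 2 * r := by
    exact_mod_cast h3
  rw [Nat.cast_mul, Nat.cast_pred hr, Nat.cast_sub (Nat.pow_le_pow_left (Nat.mod_le n r) 2)] at h4
  push_cast at h4 ⊢
  have h5 : ((n % r : ℕ) : ℝ) ^ 2 ≤ (r : ℝ) ^ 2 := by
    gcongr
  have h6 : (0 : ℝ) ≤ ((n % r).choose 2 : ℝ) := by positivity
  have hr1 : (1 : ℝ) ≤ r := by exact_mod_cast hr
  have h7 : ((n : ℝ) ^ 2 - r ^ 2) * (r - 1) ≤ ((n : ℝ) ^ 2 - ((n % r : ℕ) : ℝ) ^ 2) * (r - 1) := by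
    gcongr
  have h8 : (1 - 1 / (r : ℝ)) * r = r - 1 := by field_simp
  have h9 : ((1 - 1 / (r : ℝ) - ε) * (n : ℝ) ^ 2) * r ≤ (2 * (q : ℝ)) * r := by
    have h10 : ((1 - 1 / (r : ℝ) - ε) * (n : ℝ) ^ 2) * r =
        (n : ℝ) ^ 2 * ((1 - 1 / (r : ℝ)) * r) - ε * (n : ℝ) ^ 2 * r := by ring
    rw [h10, h8]
    nlinarith
  have h11 := le_of_mul_le_mul_right h9 hr0
  linarith

theorem N_le_ex {W U : Type*} {n : ℕ} (H : SimpleGraph W) {F : SimpleGraph U}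
    {G : SimpleGraph (Fin n)} (hG : F.Free G) : N H G ≤ ex n H F := by
  classical
  exact Finset.le_sup (f := fun G => N H G) (by simpa using hG)

theorem free_of_colorable {U V : Type*} {F : SimpleGraph U} {G : SimpleGraph V} {r : ℕ}
    (hF : ¬ F.Colorable r) (hG : G.Colorable r) : F.Free G := by
  rintro ⟨f⟩
  exact hF (hG.of_hom f.toHom)

theorem turanGraph_colorable (n : ℕ) {r : ℕ} (hr : 0 < r) :
    (SimpleGraph.turanGraph n r).Colorable r :=
  ⟨SimpleGraph.Coloring.mk (fun v => (⟨v % r, Nat.mod_lt _ hr⟩ : Fin r))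
    fun {v w} h he => h (by simpa using he)⟩

/-- The empty graph attests that an edgeless `H` has extremal graphs far from the Turán graph. -/
theorem exists_adj_of_extremalGraphsAreTExtremal {U W : Type*} [Finite W] {F : SimpleGraph U}
    {H : SimpleGraph W} {k : ℕ} (hk : 3 ≤ k) (hF : F ≠ ⊥)
    (hT : ExtremalGraphsAreTExtremal k H F) : ∃ w₀ w₁, H.Adj w₀ w₁ := by
  by_contra hcon
  push Not at hcon
  have := Fintype.ofFinite W
  have hr : 1 ≤ k - 1 := by omega
  obtain ⟨n, h1, h2, hn⟩ := ((hT (1 / 16) (by norm_num)).and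
    ((eventually_le_twice_e_turanGraph hr (ε := 1 / 4) (by norm_num)).and
      (Filter.eventually_ge_atTop 1))).exists
  have hext : IsExtremalGraph H F (⊥ : SimpleGraph (Fin n)) := by
    refine ⟨SimpleGraph.free_bot hF, (N_le_ex H (SimpleGraph.free_bot hF)).antisymm ?_⟩
    classical
    refine Finset.sup_le fun G _ => (N_le_iff H _ _).2 (card_le_card fun f hf => ?_)
    exact mem_labelledCopies.2 ⟨(mem_labelledCopies.1 hf).1, fun a b h => absurd h (hcon a b)⟩
  have h3 := (abs_le.1 (h1 _ hext)).1
  have h4 : e (⊥ : SimpleGraph (Fin n)) = 0 := by simp [e]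
  rw [h4, Nat.cast_zero, zero_sub, neg_le_neg_iff] at h3
  have h5 : (1 : ℝ) / ((k - 1 : ℕ) : ℝ) ≤ 1 / 2 := by
    apply one_div_le_one_div_of_le (by norm_num)
    have : 2 ≤ k - 1 := by omega
    exact_mod_cast this
  have hn' : (1 : ℝ) ≤ n := by exact_mod_cast hn
  nlinarith

end GenTuran

theorem theorem3 {U W : Type*} [Finite U] [Finite W] (F : SimpleGraph U) (H : SimpleGraph W)
    (k : ℕ) (hk : 3 ≤ k) (hF : F.chromaticNumber = (k : ℕ∞))
    (hcrit : GenTuran.HasColorCriticalEdge F)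
    (hconn : H.Connected) (hH : H.chromaticNumber < (k : ℕ∞))
    (hT : GenTuran.ExtremalGraphsAreTExtremal k H F)
    (hweak : GenTuran.WeakTProperty k H) :
    ∃ n₀ : ℕ, ∀ n : ℕ, n₀ ≤ n → ∀ G : SimpleGraph (Fin n), GenTuran.IsExtremalGraph H F G →
      Nonempty (G ≃g SimpleGraph.turanGraph n (k - 1)) := by
  classical
  have := Fintype.ofFinite U
  have := Fintype.ofFinite W
  obtain ⟨u₀, v₀, φ, hφ⟩ := GenTuran.exists_isCriticalColoring hk hF hcrit
  have hk1 : k - 1 + 1 = k := by omega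
  have hFcol : F.Colorable (k - 1 + 1) := by
    rw [hk1]; exact SimpleGraph.chromaticNumber_le_iff_colorable.1 hF.le
  have hFnot : ¬ F.Colorable (k - 1) := fun h => by
    have h2 := h.chromaticNumber_le
    rw [hF] at h2
    have h3 : k ≤ k - 1 := by exact_mod_cast h2
    omega
  have hHcol : H.Colorable (k - 1) := by
    rw [← hk1] at hH
    push_cast at hH
    exact SimpleGraph.chromaticNumber_le_iff_colorable.1 (Order.le_of_lt_add_one hH)
  have hFbot : F ≠ ⊥ := by
    rintro rfl
    exact hφ.1
  obtain ⟨w₀, w₁, hw⟩ := GenTuran.exists_adj_of_extremalGraphsAreTExtremal hk hFbot hT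
  obtain ⟨ε, hε, n₁, hn₁⟩ := GenTuran.exists_coloring_of_forall_N_le hφ hFcol (by omega) hHcol hw
  refine Filter.eventually_atTop.1 ?_
  filter_upwards [hT (ε / 4) (by positivity), hweak, Filter.eventually_ge_atTop n₁,
    GenTuran.eventually_le_twice_e_turanGraph (r := k - 1) (by omega) (half_pos hε)]
    with n hTn hweakn hnn₁ hturan G hG
  have hmax : ∀ G' : SimpleGraph (Fin n), F.Free G' → GenTuran.N H G' ≤ GenTuran.N H G :=
    fun G' hG' => (GenTuran.N_le_ex H hG').trans hG.2.ge
  obtain ⟨κ, hκ, hlarge⟩ := hn₁ G hG.1 hmax (by simpa using hnn₁) (by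
    have h1 := (abs_le.1 (hTn G hG)).1
    rw [GenTuran.twiceEdges_univ_eq, Fintype.card_fin]
    push_cast
    nlinarith)
  have hKcol : ((⊤ : SimpleGraph (Fin (k - 1))).comap κ).Colorable (k - 1) :=
    ⟨SimpleGraph.Coloring.mk κ fun {a b} h => h⟩
  have hGK := GenTuran.eq_of_N_le hHcol hw κ (fun _ _ => Iff.rfl) hκ hlarge
    (hmax _ (GenTuran.free_of_colorable hFnot hKcol))
  obtain ⟨iso⟩ := GenTuran.nonempty_completePartite_iso κ
  have hsum : ∑ i, Finset.card {v | κ v = i} = n := by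
    have := Finset.card_eq_sum_card_fiberwise (f := κ) (s := Finset.univ) (t := Finset.univ)
      (fun _ _ => Finset.mem_coe.2 (Finset.mem_univ _))
    simpa using this.symm
  obtain ⟨hle, hiff⟩ := hweakn _ (fun i => (Nat.zero_le _).trans_lt (hlarge i)) hsum
  have hcongr := GenTuran.N_congr H iso
  rw [← hGK] at iso hcongr
  have hT' := hmax _ (GenTuran.free_of_colorable hFnot
    (GenTuran.turanGraph_colorable n (r := k - 1) (by omega)))
  obtain ⟨iso'⟩ := hiff.1 (hle.antisymm (hT'.trans hcongr.ge))
  exact ⟨iso.symm.trans iso'⟩
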